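/- Let $S^2\subset\mathbb R^3$ be the unit sphere with surface measure $dS$ and Laplace operator $\Delta$, and put $\lambda_j=j(j+1)$ for $j=0,1,2,\dots$. Let $L^2_b(S^2)=\{\zeta\in L^2(S^2):\int_{S^2}\zeta\,dS=0\}$ (complex-valued functions), on which $\Delta$ has the inverse $\Delta^{-1}$, and for $k\in\mathbb Z$ let $V_k=\{\zeta\in L^2_b(S^2):X_3\zeta=ik\zeta\}$, where $X_3=x_1\partial_2-x_2\partial_1$ generates the $2\pi$-periodic rotation about the $x_3$-axis (both $\Delta$ and $X_3$ act in the sense of distributions). Let $f=f(x_3)$ be a smooth real-valued zonal function on $S^2$ with $\Delta f=-\lambda_\nu f$ for some integer $\nu\ge 0$, let $\alpha,\Omega\in\mathbb R$, and set $$A(x_3)=\alpha f'(x_3),\qquad B(x_3)=\Omega+\lambda_\nu\alpha f'(x_3).$$ Let $k\in\mathbb Z$, $k\ne 0$. Then $$M_k\zeta=A(x_3)\zeta+B(x_3)\Delta^{-1}\zeta,\qquad \zeta\in V_k,$$ defines a bounded linear operator $M_k:V_k\to V_k$, and $$\operatorname{Spec}M_k\subset\mathbb R$$ provided that either $\Omega+\lambda_\nu\alpha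 f'(x_3)$ does not change sign on $[-1,1]$ or $\lambda_\nu\le\lambda_{|k|}$. -/

import Mathlib

open MeasureTheory
open scoped ContDiff

namespace ZonalSphere

/-- Euclidean three-space. -/
abbrev E3 : Type := EuclideanSpace ℝ (Fin 3)

/-- The unit sphere `S²`. -/
abbrev S2 : Type := Metric.sphere (0 : E3) 1

/-- The surface measure `dS` on `S²` (total mass `4π`). -/
noncomputable abbrev surf : Measure S2 := (volume : Measure E3).toSphere

/-- The Hilbert space `L²(S²)` of complex-valued functions. -/
abbrev L2S : Type := Lp ℂ 2 surf

/-- The Laplace–Beltrami operator of `S²`, evaluated at `x ∈ S²`, on (the restriction to `S²` of)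
a function `φ`: the Euclidean Laplacian at `x` of the extension of `φ|S²` that is constant on rays.
Only the values of `φ` on `S²` matter. -/
noncomputable def sphereLaplacian {F : Type*} [NormedAddCommGroup F] [NormedSpace ℝ F]
    (φ : E3 → F) (x : S2) : F :=
  Laplacian.laplacian (fun y : E3 => φ (‖y‖⁻¹ • y)) (x : E3)

/-- The vector field `X₃ = x₁ ∂₂ - x₂ ∂₁` on `S²`, which generates the `2π`-periodic rotation
about the `x₃`-axis (coordinates are indexed by `0, 1, 2`), applied to `φ` at `x`. -/
noncomputable def X3 (φ : E3 → ℂ) (x : S2) : ℂ :=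
  fderiv ℝ φ (x : E3) !₂[-(x : E3) 1, (x : E3) 0, 0]

/-- `Δ η = ζ` on `S²` in the sense of distributions. The smooth functions on `S²` are exactly the
restrictions of the smooth functions on `ℝ³`. -/
def HasLaplacian (η ζ : L2S) : Prop :=
  ∀ φ : E3 → ℂ, ContDiff ℝ ∞ φ →
    ∫ x : S2, η x * sphereLaplacian φ x ∂surf = ∫ x : S2, ζ x * φ x ∂surf

/-- `X₃ η = ζ` on `S²` in the sense of distributions (`X₃` is divergence free). -/
def HasX3 (η ζ : L2S) : Prop :=
  ∀ φ : E3 → ℂ, ContDiff ℝ ∞ φ →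
    ∫ x : S2, η x * X3 φ x ∂surf = - ∫ x : S2, ζ x * φ x ∂surf

theorem continuous_X3 {φ : E3 → ℂ} (hφ : ContDiff ℝ ∞ φ) : Continuous (X3 φ) := by
  have h1 : Continuous (fun x : S2 => fderiv ℝ φ (x : E3)) :=
    (hφ.continuous_fderiv (by simp)).comp continuous_subtype_val
  have h2 : Continuous (fun x : S2 => (!₂[-(x : E3) 1, (x : E3) 0, 0] : E3)) := by
    apply (PiLp.continuous_toLp 2 _).comp
    refine continuous_pi fun i => ?_
    fin_cases i <;> simp <;> fun_prop
  exact h1.clm_apply h2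

theorem integrable_mul (f : L2S) {g : S2 → ℂ} (hg : Continuous g) :
    Integrable (fun x => f x * g x) surf := by
  have hf : Integrable f surf := (Lp.memLp f).integrable (by norm_num)
  obtain ⟨C, hC⟩ := isCompact_univ.exists_bound_of_continuousOn (f := g) hg.continuousOn
  exact hf.mul_bdd (c := C) hg.aestronglyMeasurable
    (Filter.Eventually.of_forall fun x => hC x (Set.mem_univ x))

theorem integral_add_mul (f f' : L2S) {g : S2 → ℂ} (hg : Continuous g) :
    ∫ x, (f + f' : L2S) x * g x ∂surf = ∫ x, f x * g x ∂surf + ∫ x, f' x * g x ∂surf := by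
  rw [← integral_add (integrable_mul f hg) (integrable_mul f' hg)]
  refine integral_congr_ae ?_
  filter_upwards [Lp.coeFn_add f f'] with x hx
  rw [hx, Pi.add_apply, add_mul]

theorem integral_smul_mul (c : ℂ) (f : L2S) (g : S2 → ℂ) :
    ∫ x, (c • f : L2S) x * g x ∂surf = c * ∫ x, f x * g x ∂surf := by
  rw [← integral_const_mul]
  refine integral_congr_ae ?_
  filter_upwards [Lp.coeFn_smul c f] with x hx
  rw [hx, Pi.smul_apply, smul_eq_mul, mul_assoc]

/-- `L²_b(S²)`: the functions in `L²(S²)` with integral zero. -/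
noncomputable def L2b : Submodule ℂ L2S where
  carrier := {f | ∫ x, f x ∂surf = 0}
  zero_mem' := by
    have h := integral_smul_mul 0 0 (fun _ => 1)
    simpa using h
  add_mem' := by
    intro f g hf hg
    have h := integral_add_mul f g (g := fun _ => 1) continuous_const
    simp only [mul_one] at h
    simp only [Set.mem_ofPred_eq] at hf hg ⊢
    rw [h, hf, hg, add_zero]
  smul_mem' := by
    intro c f hf
    have h := integral_smul_mul c f (fun _ => 1)
    simp only [mul_one] at h
    simp only [Set.mem_ofPred_eq] at hf ⊢
    rw [h, hf, mul_zero]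

/-- `V_k = {ζ ∈ L²_b(S²) : X₃ ζ = i k ζ}`. -/
noncomputable def V (k : ℤ) : Submodule ℂ L2S where
  carrier := {f | f ∈ L2b ∧ HasX3 f ((Complex.I * (k : ℂ)) • f)}
  zero_mem' := by
    refine ⟨L2b.zero_mem, fun φ _ => ?_⟩
    have h := integral_smul_mul 0 0 (X3 φ)
    have e := integral_smul_mul 0 0 (fun x : S2 => φ x)
    rw [zero_smul, zero_mul] at h e
    rw [smul_zero, h, e, neg_zero]
  add_mem' := by
    rintro f g ⟨hf, hf'⟩ ⟨hg, hg'⟩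
    refine ⟨L2b.add_mem hf hg, fun φ hφ => ?_⟩
    have hc : Continuous (fun x : S2 => φ x) := hφ.continuous.comp continuous_subtype_val
    rw [smul_add, integral_add_mul _ _ (continuous_X3 hφ), integral_add_mul _ _ hc, hf' φ hφ,
      hg' φ hφ, neg_add]
  smul_mem' := by
    rintro c f ⟨hf, hf'⟩
    refine ⟨L2b.smul_mem c hf, fun φ hφ => ?_⟩
    rw [smul_comm, integral_smul_mul, integral_smul_mul c _ (fun x : S2 => φ x), hf' φ hφ, mul_neg]

/-- `η = Δ⁻¹ ζ`, where `Δ⁻¹` is the inverse of the Laplace operator on `L²_b(S²)`. -/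
def IsInvLaplacian (ζ η : L2S) : Prop :=
  η ∈ L2b ∧ HasLaplacian η ζ

/-- `T` is the operator `M_k : V_k → V_k`, `M_k ζ = A(x₃) ζ + B(x₃) Δ⁻¹ ζ`. -/
def IsM (A B : ℝ → ℝ) (k : ℤ) (T : V k →L[ℂ] V k) : Prop :=
  ∀ ζ : V k, ∃ η : L2S, IsInvLaplacian (ζ : L2S) η ∧
    ∀ᵐ x : S2 ∂surf, (T ζ : L2S) x =
      (A ((x : E3) 2) : ℂ) * (ζ : L2S) x + (B ((x : E3) 2) : ℂ) * η x

/-- `λ_j = j (j + 1)`, the eigenvalues of `-Δ` on `S²`. -/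
def lam (j : ℕ) : ℝ := j * (j + 1)

/-- The zonal function `x ↦ f(x₃)`, with `f` smooth on `[-1, 1]`, satisfies `Δ f = -λ_ν f`
on `S²` (the zero function is allowed). -/
def IsZonalEigenfunction (f : ℝ → ℝ) (ν : ℕ) : Prop :=
  ContDiffOn ℝ ∞ f (Set.Icc (-1) 1) ∧
    ∀ x : S2, sphereLaplacian (fun y : E3 => f (y 2)) x = -lam ν * f ((x : E3) 2)

/-- The derivative `f'` of a function on `[-1, 1]` (one-sided at the endpoints). -/
noncomputable def D (f : ℝ → ℝ) (s : ℝ) : ℝ := derivWithin f (Set.Icc (-1) 1) s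

end ZonalSphere

/-! Write `K` for `Δ⁻¹` on `V k`, and `A`, `B` for the multiplication operators, which are symmetric
and commute. The point of the spectrum of `A + B K` with largest |Im| is an approximate eigenvalue
whenever it is not real, so it suffices to exclude a Weyl sequence: unit vectors ζ with (A - z)ζ + B
K ζ → 0 and Im z ≠ 0. Put u = (A - z)⁻¹ K ζ. Then ζ + B u → 0, and pairing with K ζ gives ⟨Kζ, ζ⟩ =
-⟨Au, Bu⟩ + z̄⟨u, Bu⟩ + o(1). All three inner products are real, so the imaginary part forces ⟨u,
Bu⟩ → 0 (`exists_seq_of_approx_eigenvector`).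

If B has one sign, ‖Bu‖² ≤ C|⟨u, Bu⟩| → 0, hence ζ → 0, a contradiction
(`spectrum_subset_real_of_definite`). If B = Ω + μA with μ = λ_ν > 0, then μ⟨Au, Bu⟩ = ‖Bu‖² - Ω⟨u,
Bu⟩ → 1, so μ⟨Kζ, ζ⟩ → -1. On `V k` one has K ≥ -1/κ with κ = λ_|k|, which excludes μ < κ. When μ =
κ, ζ must be asymptotically an eigenvector of K for -1/κ, and then (A + BK)ζ ≈ -(Ω/κ)ζ, so z would
be real (`spectrum_subset_real_of_affine`).

The concrete input is `exists_inverse_laplacian`: K exists on `V k`, is symmetric and satisfies the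
bound with λ_|k|. It is diagonal in the functions (x₀ ± i x₁)^|k| p(x₂), on which Δ acts as a
triangular operator on polynomials p. Completeness of these functions comes from Stone–Weierstrass.
-/

namespace ZonalSphere

/-! ### Rotation fields and the Laplacian as the sum of their squares -/

/-- The derivative of `φ` along the linear vector field `y ↦ L y`. -/
noncomputable def lieDeriv (L : E3 →L[ℝ] E3) (φ : E3 → ℂ) (y : E3) : ℂ := fderiv ℝ φ y (L y)

theorem contDiff_lieDeriv (L : E3 →L[ℝ] E3) {φ : E3 → ℂ} (hφ : ContDiff ℝ ∞ φ) :
    ContDiff ℝ ∞ (lieDeriv L φ) :=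
  (hφ.fderiv_right (m := ∞) (by simp)).clm_apply L.contDiff

theorem lieDeriv_lieDeriv (L : E3 →L[ℝ] E3) {φ : E3 → ℂ} {x : E3} (hφ : ContDiffAt ℝ 2 φ x) :
    lieDeriv L (lieDeriv L φ) x =
      fderiv ℝ (fderiv ℝ φ) x (L x) (L x) + fderiv ℝ φ x (L (L x)) := by
  have h1 : DifferentiableAt ℝ (fderiv ℝ φ) x :=
    (hφ.fderiv_right (m := 1) (by norm_num)).differentiableAt (by norm_num)
  have h2 := h1.hasFDerivAt.clm_apply L.hasFDerivAt
  unfold lieDeriv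
  rw [h2.fderiv]
  simp [add_comm]

/-- The generators of the rotations about the three coordinate axes. -/
noncomputable def gen (i : Fin 3) : E3 →L[ℝ] E3 :=
  LinearMap.toContinuousLinearMap
    { toFun := fun y => ![!₂[0, -y 2, y 1], !₂[y 2, 0, -y 0], !₂[-y 1, y 0, 0]] i
      map_add' := by
        intro x y
        fin_cases i <;> ext j <;> fin_cases j <;> simp [add_comm]
      map_smul' := by
        intro c y
        fin_cases i <;> ext j <;> fin_cases j <;> simp }

theorem gen_zero (y : E3) : gen 0 y = !₂[0, -y 2, y 1] := rfl
theorem gen_one (y : E3) : gen 1 y = !₂[y 2, 0, -y 0] := rfl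
theorem gen_two (y : E3) : gen 2 y = !₂[-y 1, y 0, 0] := rfl

theorem gen_cube (i : Fin 3) (y : E3) : gen i (gen i (gen i y)) = -gen i y := by
  fin_cases i <;> ext j <;> fin_cases j <;> simp [gen_zero, gen_one, gen_two]

theorem inner_gen (i : Fin 3) (y z : E3) : inner ℝ (gen i y) z = -inner ℝ y (gen i z) := by
  simp only [PiLp.inner_apply, Fin.sum_univ_three]
  fin_cases i <;> simp [gen_zero, gen_one, gen_two]

/-- Rodrigues' formula for the rotation by the angle `t`. -/
noncomputable def rotation (i : Fin 3) (t : ℝ) : E3 ≃ₗᵢ[ℝ] E3 :=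
  LinearIsometry.toLinearIsometryEquiv
    { toLinearMap :=
        ((1 : E3 →L[ℝ] E3) + Real.sin t • gen i + (1 - Real.cos t) • (gen i * gen i) : E3 →L[ℝ] E3)
      norm_map' := by
        intro y
        rw [← sq_eq_sq₀ (norm_nonneg _) (norm_nonneg _), ← real_inner_self_eq_norm_sq,
          ← real_inner_self_eq_norm_sq]
        have h1 : inner ℝ y (gen i y) = 0 := by
          have := inner_gen i y y
          rw [real_inner_comm] at this
          linarith
        have h2 : inner ℝ y (gen i (gen i y)) = -inner ℝ (gen i y) (gen i y) := by
          rw [inner_gen, neg_neg]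
        have h3 : inner ℝ (gen i (gen i y)) (gen i (gen i y)) = inner ℝ (gen i y) (gen i y) := by
          rw [inner_gen, gen_cube, inner_neg_right, neg_neg]
        have h4 : inner ℝ (gen i y) (gen i (gen i y)) = 0 := by
          have := inner_gen i (gen i y) (gen i y)
          rw [real_inner_comm] at this
          linarith
        have h1' := h1
        have h2' := h2
        have h4' := h4
        rw [real_inner_comm] at h1' h2' h4'
        simp only [ContinuousLinearMap.coe_coe, add_apply, one_apply_eq_self, smul_apply,
          mul_apply_eq_comp, inner_add_left, inner_add_right, inner_smul_left,
          inner_smul_right, h1, h2, h3, h4, h1', h2', h4', conj_trivial]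
        linear_combination inner ℝ (gen i y) (gen i y) * Real.sin_sq_add_cos_sq t }
    rfl

theorem rotation_apply (i : Fin 3) (t : ℝ) (y : E3) :
    rotation i t y = y + Real.sin t • gen i y + (1 - Real.cos t) • gen i (gen i y) := rfl

theorem rotation_zero (i : Fin 3) (y : E3) : rotation i 0 y = y := by
  simp [rotation_apply]

theorem hasDerivAt_rotation (i : Fin 3) (t : ℝ) (y : E3) :
    HasDerivAt (fun t => rotation i t y) (gen i (rotation i t y)) t := by
  have h := (((Real.hasDerivAt_sin t).smul_const (gen i y)).const_add y).add
    (((Real.hasDerivAt_cos t).const_sub 1).smul_const (gen i (gen i y)))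
  refine h.congr_deriv ?_
  rw [rotation_apply, map_add, map_add, map_smul, map_smul, gen_cube]
  module

theorem hasDerivAt_comp_rotation (i : Fin 3) {φ : E3 → ℂ} (t : ℝ) (y : E3)
    (hφ : DifferentiableAt ℝ φ (rotation i t y)) :
    HasDerivAt (fun t => φ (rotation i t y)) (lieDeriv (gen i) φ (rotation i t y)) t :=
  hφ.hasFDerivAt.comp_hasDerivAt t (hasDerivAt_rotation i t y)

/-- Extension of `φ` from the sphere, constant on rays. -/
noncomputable def radialExt (φ : E3 → ℂ) (y : E3) : ℂ := φ (‖y‖⁻¹ • y)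

theorem radialExt_of_mem {φ : E3 → ℂ} {x : E3} (hx : ‖x‖ = 1) : radialExt φ x = φ x := by
  simp [radialExt, hx]

theorem contDiffAt_radialExt {φ : E3 → ℂ} (hφ : ContDiff ℝ ∞ φ) {y : E3} (hy : y ≠ 0) :
    ContDiffAt ℝ ∞ (radialExt φ) y := by
  refine hφ.contDiffAt.comp y ?_
  exact ((contDiffAt_norm ℝ hy).inv (norm_ne_zero_iff.2 hy)).smul contDiffAt_id

/-- Rotations preserve the norm, so both sides are the derivative at t = 0 of the same function of
t. -/
theorem lieDeriv_gen_radialExt (i : Fin 3) {φ : E3 → ℂ} (hφ : ContDiff ℝ ∞ φ) {y : E3}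
    (hy : y ≠ 0) : lieDeriv (gen i) (radialExt φ) y = radialExt (lieDeriv (gen i) φ) y := by
  have h1 := hasDerivAt_comp_rotation i (φ := radialExt φ) 0 y (by
    rw [rotation_zero]
    exact (contDiffAt_radialExt hφ hy).differentiableAt (by simp))
  have h2 := hasDerivAt_comp_rotation i (φ := φ) 0 (‖y‖⁻¹ • y)
    ((hφ.differentiable (by simp)) _)
  rw [rotation_zero] at h1 h2
  refine h1.unique (h2.congr_of_eventuallyEq ?_)
  refine Filter.Eventually.of_forall fun t => ?_
  simp [radialExt]

theorem lieDeriv_id_radialExt {φ : E3 → ℂ} (hφ : ContDiff ℝ ∞ φ) {y : E3}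
    (hy : y ≠ 0) : lieDeriv (.id ℝ E3) (radialExt φ) y = 0 := by
  -- The curve `exp t • y` stays on the open ray through `y`, along which the extension is constant.
  have h0 : HasDerivAt (fun t : ℝ => Real.exp t • y) y 0 := by
    simpa using (Real.hasDerivAt_exp 0).smul_const y
  have h1 : HasFDerivAt (radialExt φ) (fderiv ℝ (radialExt φ) y) (Real.exp 0 • y) := by
    rw [Real.exp_zero, one_smul]
    exact ((contDiffAt_radialExt hφ hy).differentiableAt (by simp)).hasFDerivAt
  have h2 := h1.comp_hasDerivAt (0 : ℝ) h0
  refine h2.unique ((hasDerivAt_const (0 : ℝ) (radialExt φ y)).congr_of_eventuallyEq ?_)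
  refine Filter.Eventually.of_forall fun t => ?_
  simp only [Function.comp, radialExt, norm_smul, Real.norm_eq_abs, Real.abs_exp, mul_inv, smul_smul]
  congr 2
  field_simp

theorem lieDeriv_congr_of_eventuallyEq (L : E3 →L[ℝ] E3) {φ ψ : E3 → ℂ} {x : E3}
    (h : φ =ᶠ[nhds x] ψ) : lieDeriv L φ x = lieDeriv L ψ x := by
  unfold lieDeriv
  rw [h.fderiv_eq]

/-- Since `gen i x` is the cross product eᵢ × x, the sum of (eᵢ × x)(eᵢ × x)ᵀ is |x|² I - x xᵀ;
contract this with `H`. -/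
theorem sum_bilin_gen (H : E3 →L[ℝ] E3 →L[ℝ] ℂ) (x : E3) :
    ∑ i, H (gen i x) (gen i x) =
      (‖x‖ ^ 2 : ℝ) * ∑ i, H (EuclideanSpace.single i 1) (EuclideanSpace.single i 1) - H x x := by
  have key : ∀ y : E3, y = y 0 • EuclideanSpace.single (0 : Fin 3) (1 : ℝ) +
      y 1 • EuclideanSpace.single (1 : Fin 3) (1 : ℝ) +
      y 2 • EuclideanSpace.single (2 : Fin 3) (1 : ℝ) := by
    intro y
    ext j
    fin_cases j <;> simp
  rw [EuclideanSpace.real_norm_sq_eq]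
  simp only [Fin.sum_univ_three]
  rw [key (gen 0 x), key (gen 1 x), key (gen 2 x)]
  conv_rhs => rw [key x]
  simp only [map_add, map_smul, add_apply, smul_apply,
    gen_zero, gen_one, gen_two]
  simp
  ring

theorem sum_gen_gen (x : E3) : ∑ i, gen i (gen i x) = (-2 : ℝ) • x := by
  ext j
  simp only [Fin.sum_univ_three]
  fin_cases j <;> simp [gen_zero, gen_one, gen_two] <;> ring

/-- For the radial extension, the sum of squares is the Euclidean Laplacian minus radial derivatives
of first and second order, and these vanish. This replaces charts in all that follows. -/
theorem sphereLaplacian_eq_sum {φ : E3 → ℂ} (hφ : ContDiff ℝ ∞ φ) (x : S2) :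
    sphereLaplacian φ x = ∑ i, lieDeriv (gen i) (lieDeriv (gen i) φ) x := by
  obtain ⟨x, hx⟩ := x
  have hn : ‖x‖ = 1 := by simpa using hx
  have h0 : x ≠ 0 := by rintro rfl; simp at hn
  have hne : ∀ᶠ y in nhds x, y ≠ 0 := isOpen_ne.mem_nhds h0
  have hC : ContDiffAt ℝ 2 (radialExt φ) x := 
    contDiffAt_infty.1 (contDiffAt_radialExt hφ h0) 2
  have e1 : ∀ i, lieDeriv (gen i) (lieDeriv (gen i) φ) x =
      lieDeriv (gen i) (lieDeriv (gen i) (radialExt φ)) x := by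
    intro i
    rw [lieDeriv_congr_of_eventuallyEq (gen i) (hne.mono fun y hy => lieDeriv_gen_radialExt i hφ hy),
      lieDeriv_gen_radialExt i (contDiff_lieDeriv _ hφ) h0, radialExt_of_mem hn]
  have e2 : lieDeriv (.id ℝ E3) (lieDeriv (.id ℝ E3) (radialExt φ)) x = 0 := by
    rw [lieDeriv_congr_of_eventuallyEq (.id ℝ E3) (hne.mono fun y hy => lieDeriv_id_radialExt hφ hy)]
    simp [lieDeriv]
  have e3 : fderiv ℝ (radialExt φ) x x = 0 := lieDeriv_id_radialExt hφ h0
  rw [lieDeriv_lieDeriv _ hC] at e2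
  simp only [ContinuousLinearMap.id_apply, e3, add_zero] at e2
  simp only [e1, lieDeriv_lieDeriv _ hC, Finset.sum_add_distrib, sum_bilin_gen, ← map_sum,
    sum_gen_gen, map_smul, e2, e3, hn]
  unfold sphereLaplacian
  change Laplacian.laplacian (radialExt φ) x = _
  rw [InnerProductSpace.laplacian_eq_iteratedFDeriv_orthonormalBasis _
    (EuclideanSpace.basisFun (Fin 3) ℝ)]
  simp [iteratedFDeriv_two_apply]

/-! ### Rotation invariance of the surface measure and integration by parts -/

/-- The action of a linear isometry on the sphere. -/
noncomputable def sphereMap (R : E3 ≃ₗᵢ[ℝ] E3) (x : S2) : S2 :=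
  ⟨R x, by simp⟩

theorem continuous_sphereMap (R : E3 ≃ₗᵢ[ℝ] E3) : Continuous (sphereMap R) :=
  (R.continuous.comp continuous_subtype_val).subtype_mk _

open scoped Pointwise in
-- The surface measure of a set is a multiple of the volume of the cone over it, and a linear
-- isometry maps cones to cones and preserves volume.
theorem map_sphereMap (R : E3 ≃ₗᵢ[ℝ] E3) : surf.map (sphereMap R) = surf := by
  ext s hs
  have hm := (continuous_sphereMap R).measurable
  rw [Measure.map_apply hm hs, Measure.toSphere_apply' _ hs, Measure.toSphere_apply' _ (hm hs)]
  congr 1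
  have : (Set.Ioo (0 : ℝ) 1 • ((↑) '' (sphereMap R ⁻¹' s)) : Set E3) =
      R ⁻¹' (Set.Ioo (0 : ℝ) 1 • ((↑) '' s)) := by
    ext y
    simp only [Set.mem_smul, Set.mem_image, Set.mem_preimage]
    constructor
    · rintro ⟨r, hr, _, ⟨x, hx, rfl⟩, rfl⟩
      exact ⟨r, hr, _, ⟨_, hx, rfl⟩, by simp [sphereMap]⟩
    · rintro ⟨r, hr, _, ⟨x, hx, rfl⟩, hy⟩
      refine ⟨r, hr, _, ⟨sphereMap R.symm x, ?_, rfl⟩, ?_⟩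
      · have : sphereMap R (sphereMap R.symm x) = x := by ext1; simp [sphereMap]
        rwa [this]
      · apply R.injective
        rw [← hy]
        simp [sphereMap]
  rw [this]
  exact R.measurePreserving.measure_preimage_emb R.toHomeomorph.measurableEmbedding _

theorem integral_comp_isometry (R : E3 ≃ₗᵢ[ℝ] E3) {φ : E3 → ℂ} (hφ : Continuous φ) :
    ∫ x : S2, φ (R x) ∂surf = ∫ x : S2, φ x ∂surf := by
  conv_rhs => rw [← map_sphereMap R]
  exact (integral_map (f := fun x : S2 => φ x) (continuous_sphereMap R).measurable.aemeasurable
    (hφ.comp continuous_subtype_val).aestronglyMeasurable).symm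

theorem integrable_of_continuous {g : S2 → ℂ} (hg : Continuous g) : Integrable g surf :=
  hg.integrable_of_hasCompactSupport (HasCompactSupport.of_compactSpace g)

/-- The integral of φ over the rotated sphere does not depend on the angle; differentiate at angle
zero. -/
theorem integral_lieDeriv (i : Fin 3) {φ : E3 → ℂ} (hφ : ContDiff ℝ ∞ φ) :
    ∫ x : S2, lieDeriv (gen i) φ x ∂surf = 0 := by
  have hc : Continuous (lieDeriv (gen i) φ) := (contDiff_lieDeriv _ hφ).continuous
  obtain ⟨C, hC⟩ := (isCompact_sphere (0 : E3) 1).exists_bound_of_continuousOn hc.continuousOn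
  have h := hasDerivAt_integral_of_dominated_loc_of_deriv_le (μ := surf) (𝕜 := ℝ)
    (F := fun t (x : S2) => φ (rotation i t x))
    (F' := fun t (x : S2) => lieDeriv (gen i) φ (rotation i t x)) (x₀ := 0) (s := Set.univ)
    (bound := fun _ => C) Filter.univ_mem
    (Filter.Eventually.of_forall fun t => (hφ.continuous.comp
      ((rotation i t).continuous.comp continuous_subtype_val)).aestronglyMeasurable)
    (integrable_of_continuous (hφ.continuous.comp
      ((rotation i 0).continuous.comp continuous_subtype_val)))
    (hc.comp ((rotation i 0).continuous.comp continuous_subtype_val)).aestronglyMeasurable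
    (Filter.Eventually.of_forall fun x t _ => hC _ (by simp))
    (integrable_const C)
    (Filter.Eventually.of_forall fun x t _ =>
      hasDerivAt_comp_rotation i t x ((hφ.differentiable (by simp)) _))
  have h2 := h.2
  simp only [integral_comp_isometry _ hφ.continuous, integral_comp_isometry _ hc] at h2
  exact h2.unique (hasDerivAt_const _ _)

theorem lieDeriv_mul (L : E3 →L[ℝ] E3) {φ ψ : E3 → ℂ} (hφ : ContDiff ℝ ∞ φ) (hψ : ContDiff ℝ ∞ ψ)
    (x : E3) : lieDeriv L (fun y => φ y * ψ y) x = φ x * lieDeriv L ψ x + lieDeriv L φ x * ψ x := by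
  unfold lieDeriv
  rw [fderiv_fun_mul (hφ.differentiable (by simp) x) (hψ.differentiable (by simp) x)]
  simp [mul_comm]

theorem integral_mul_lieDeriv (i : Fin 3) {φ ψ : E3 → ℂ} (hφ : ContDiff ℝ ∞ φ)
    (hψ : ContDiff ℝ ∞ ψ) :
    ∫ x : S2, φ x * lieDeriv (gen i) ψ x ∂surf = -∫ x : S2, lieDeriv (gen i) φ x * ψ x ∂surf := by
  have h := integral_lieDeriv i (hφ.mul hψ)
  simp only [lieDeriv_mul _ hφ hψ] at h
  rw [integral_add] at h
  · exact eq_neg_of_add_eq_zero_left h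
  · exact integrable_of_continuous ((hφ.continuous.mul (contDiff_lieDeriv _ hψ).continuous).comp
      continuous_subtype_val)
  · exact integrable_of_continuous (((contDiff_lieDeriv _ hφ).continuous.mul hψ.continuous).comp
      continuous_subtype_val)

/-- Green's identity on the sphere. -/
theorem integral_mul_sphereLaplacian {φ ψ : E3 → ℂ} (hφ : ContDiff ℝ ∞ φ)
    (hψ : ContDiff ℝ ∞ ψ) :
    ∫ x : S2, φ x * sphereLaplacian ψ x ∂surf = ∫ x : S2, sphereLaplacian φ x * ψ x ∂surf := by
  simp only [sphereLaplacian_eq_sum hφ, sphereLaplacian_eq_sum hψ, Finset.mul_sum, Finset.sum_mul]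
  rw [integral_finsetSum, integral_finsetSum]
  · refine Finset.sum_congr rfl fun i _ => ?_
    rw [integral_mul_lieDeriv i hφ (contDiff_lieDeriv _ hψ),
      integral_mul_lieDeriv i (contDiff_lieDeriv _ hφ) hψ, neg_neg]
  · intro i _
    exact integrable_of_continuous (((contDiff_lieDeriv _ (contDiff_lieDeriv _ hφ)).continuous.mul
      hψ.continuous).comp continuous_subtype_val)
  · intro i _
    exact integrable_of_continuous ((hφ.continuous.mul
      (contDiff_lieDeriv _ (contDiff_lieDeriv _ hψ)).continuous).comp continuous_subtype_val)

theorem continuous_sphereLaplacian {φ : E3 → ℂ} (hφ : ContDiff ℝ ∞ φ) :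
    Continuous (sphereLaplacian φ) := by
  have : sphereLaplacian φ = fun x : S2 => ∑ i, lieDeriv (gen i) (lieDeriv (gen i) φ) x :=
    funext (sphereLaplacian_eq_sum hφ)
  rw [this]
  exact continuous_finsetSum _ fun i _ =>
    (contDiff_lieDeriv _ (contDiff_lieDeriv _ hφ)).continuous.comp continuous_subtype_val

theorem X3_eq_lieDeriv (φ : E3 → ℂ) (x : S2) : X3 φ x = lieDeriv (gen 2) φ x := rfl

/-! ### Functions of weight k and the Legendre operator on polynomials -/

open Polynomial

/-- The linear form `x₀ ± i x₁`, the sign being that of `k`. -/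
noncomputable def planeForm (k : ℤ) : E3 →L[ℝ] ℂ :=
  Complex.ofRealCLM.comp (EuclideanSpace.proj (0 : Fin 3)) +
    ((if 0 ≤ k then 1 else -1 : ℝ) * Complex.I) •
      Complex.ofRealCLM.comp (EuclideanSpace.proj (1 : Fin 3))

/-- The linear form `x₂`. -/
noncomputable def heightForm : E3 →L[ℝ] ℂ :=
  Complex.ofRealCLM.comp (EuclideanSpace.proj (2 : Fin 3))

theorem planeForm_apply (k : ℤ) (y : E3) :
    planeForm k y = y 0 + ((if 0 ≤ k then 1 else -1 : ℝ) * Complex.I) * y 1 := by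
  simp [planeForm]

theorem heightForm_apply (y : E3) : heightForm y = y 2 := rfl

theorem contDiff_eval_form (P : ℂ[X]) (l : E3 →L[ℝ] ℂ) :
    ContDiff ℝ ∞ (fun y => P.eval (l y)) := by
  have h : ContDiff ℝ ∞ (fun z : ℂ => P.eval z) := by
    simpa [Polynomial.coe_aeval_eq_eval] using (P.contDiff_aeval (𝕜 := ℂ) ∞).restrict_scalars ℝ
  exact h.comp l.contDiff

theorem lieDeriv_eval_form (L : E3 →L[ℝ] E3) (P : ℂ[X]) (l : E3 →L[ℝ] ℂ) (y : E3) :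
    lieDeriv L (fun y => P.eval (l y)) y = P.derivative.eval (l y) * l (L y) := by
  have h := ((P.hasDerivAt (l y)).hasFDerivAt.restrictScalars ℝ).comp y l.hasFDerivAt
  unfold lieDeriv
  rw [show (fun y => P.eval (l y)) = (fun z => P.eval z) ∘ l from rfl, h.fderiv]
  simp [mul_comm]

theorem lieDeriv_lieDeriv_eval_form (L : E3 →L[ℝ] E3) (P : ℂ[X]) (l : E3 →L[ℝ] ℂ) (y : E3) :
    lieDeriv L (lieDeriv L (fun y => P.eval (l y))) y =
      P.derivative.derivative.eval (l y) * l (L y) ^ 2 +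
        P.derivative.eval (l y) * l (L (L y)) := by
  rw [funext (lieDeriv_eval_form L P l),
    show (fun y => P.derivative.eval (l y) * l (L y)) =
      fun y => P.derivative.eval (l y) * (l.comp L) y from rfl,
    lieDeriv_mul L (contDiff_eval_form _ l) (l.comp L).contDiff, lieDeriv_eval_form]
  have : lieDeriv L (l.comp L) y = l (L (L y)) := by
    unfold lieDeriv
    rw [(l.comp L).fderiv]
    rfl
  rw [this, ContinuousLinearMap.comp_apply]
  ring

theorem lieDeriv_add (L : E3 →L[ℝ] E3) {φ ψ : E3 → ℂ} (hφ : ContDiff ℝ ∞ φ) (hψ : ContDiff ℝ ∞ ψ)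
    (x : E3) : lieDeriv L (fun y => φ y + ψ y) x = lieDeriv L φ x + lieDeriv L ψ x := by
  unfold lieDeriv
  rw [fderiv_fun_add (hφ.differentiable (by simp) x) (hψ.differentiable (by simp) x)]
  simp

theorem lieDeriv_lieDeriv_mul (L : E3 →L[ℝ] E3) {φ ψ : E3 → ℂ} (hφ : ContDiff ℝ ∞ φ)
    (hψ : ContDiff ℝ ∞ ψ) (x : E3) :
    lieDeriv L (lieDeriv L (fun y => φ y * ψ y)) x =
      φ x * lieDeriv L (lieDeriv L ψ) x + 2 * lieDeriv L φ x * lieDeriv L ψ x +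
        lieDeriv L (lieDeriv L φ) x * ψ x := by
  have h1 := contDiff_lieDeriv L hφ
  have h2 := contDiff_lieDeriv L hψ
  rw [funext (lieDeriv_mul L hφ hψ), lieDeriv_add L (hφ.mul h2) (h1.mul hψ),
    lieDeriv_mul L hφ h2, lieDeriv_mul L h1 hψ]
  ring

/-- The function `(x₀ ± i x₁)^|k| p(x₂)`, of weight `k` under rotations about the third axis. -/
noncomputable def weightFun (k : ℤ) (p : ℂ[X]) (y : E3) : ℂ :=
  (X ^ k.natAbs : ℂ[X]).eval (planeForm k y) * p.eval (heightForm y)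

/-- The Laplace operator in the coordinate `p` of `weightFun k p`, where `a = |k|`. -/
noncomputable def legendreOp (a : ℕ) : ℂ[X] →ₗ[ℂ] ℂ[X] :=
  LinearMap.mulLeft ℂ (1 - X ^ 2) ∘ₗ derivative ∘ₗ derivative -
    (2 * (a + 1) : ℂ) • (LinearMap.mulLeft ℂ X ∘ₗ derivative) - (a * (a + 1) : ℂ) • LinearMap.id

theorem legendreOp_apply (a : ℕ) (p : ℂ[X]) :
    legendreOp a p = (1 - X ^ 2) * derivative (derivative p) -
      (2 * (a + 1) : ℂ) • (X * derivative p) - (a * (a + 1) : ℂ) • p := rfl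

theorem contDiff_weightFun (k : ℤ) (p : ℂ[X]) : ContDiff ℝ ∞ (weightFun k p) :=
  (contDiff_eval_form _ _).mul (contDiff_eval_form _ _)

theorem mul_eval_derivative_X_pow (a : ℕ) (z : ℂ) :
    z * (derivative (X ^ a : ℂ[X])).eval z = a * (X ^ a : ℂ[X]).eval z := by
  rcases a with _ | a
  · simp
  · simp; ring

theorem sq_mul_eval_derivative_derivative_X_pow (a : ℕ) (z : ℂ) :
    z ^ 2 * (derivative (derivative (X ^ a : ℂ[X]))).eval z =
      a * (a - 1) * (X ^ a : ℂ[X]).eval z := by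
  rcases a with _ | _ | a
  · simp
  · simp
  · simp; ring

theorem sum_sq_coord (x : S2) :
    ((x : E3) 0 : ℂ) ^ 2 + ((x : E3) 1 : ℂ) ^ 2 + ((x : E3) 2 : ℂ) ^ 2 = 1 := by
  have hn : ‖(x : E3)‖ ^ 2 = 1 := by simp
  rw [EuclideanSpace.real_norm_sq_eq, Fin.sum_univ_three] at hn
  exact_mod_cast hn

theorem sphereLaplacian_weightFun (k : ℤ) (p : ℂ[X]) (x : S2) :
    sphereLaplacian (weightFun k p) x = weightFun k (legendreOp k.natAbs p) x := by
  rw [sphereLaplacian_eq_sum (contDiff_weightFun k p)]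
  obtain ⟨x, hx⟩ := x
  have hn : (x 0 : ℂ) ^ 2 + (x 1 : ℂ) ^ 2 + (x 2 : ℂ) ^ 2 = 1 := sum_sq_coord ⟨x, hx⟩
  unfold weightFun
  simp only [lieDeriv_lieDeriv_mul _ (contDiff_eval_form _ _) (contDiff_eval_form _ _),
    lieDeriv_lieDeriv_eval_form, lieDeriv_eval_form]
  set a := k.natAbs
  have e1 := mul_eval_derivative_X_pow a (planeForm k x)
  have e2 := sq_mul_eval_derivative_derivative_X_pow a (planeForm k x)
  set q : ℂ[X] := X ^ a
  set ε : ℂ := ((if 0 ≤ k then 1 else -1 : ℝ) : ℂ) with hε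
  have hε2 : ε ^ 2 = 1 := by rw [hε]; split_ifs <;> simp
  generalize eval (planeForm k x) q = q0 at *
  generalize eval (planeForm k x) (derivative q) = q1 at *
  generalize eval (planeForm k x) (derivative (derivative q)) = q2 at *
  simp only [legendreOp_apply, eval_sub, eval_mul, eval_smul, eval_one, eval_pow, eval_X,
    smul_eq_mul]
  generalize eval (heightForm x) p = p0
  generalize eval (heightForm x) (derivative p) = p1
  generalize eval (heightForm x) (derivative (derivative p)) = p2
  have he : (ε * Complex.I) ^ 2 = -1 := by rw [mul_pow, hε2, Complex.I_sq, one_mul]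
  simp only [planeForm_apply, heightForm_apply, ← hε, Fin.sum_univ_three, gen_zero, gen_one,
    gen_two] at *
  simp only [Matrix.cons_val, Complex.ofReal_neg, Complex.ofReal_zero]
  generalize ε * Complex.I = e at *
  -- A polynomial identity modulo the sphere equation, e² = -1 (the plane form is isotropic) and the
  -- two relations for derivatives of z^a.
  linear_combination q0 * p2 * hn - (2 * p1 * x 2 + 2 * p0) * e1 - p0 * e2 +
    p0 * q2 * ((x 0 : ℂ) ^ 2 + x 1 ^ 2 + x 2 ^ 2) * he

theorem lieDeriv_two_weightFun (k : ℤ) (p : ℂ[X]) (x : E3) :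
    lieDeriv (gen 2) (weightFun k p) x = Complex.I * k * weightFun k p x := by
  unfold weightFun
  rw [lieDeriv_mul _ (contDiff_eval_form _ _) (contDiff_eval_form _ _), lieDeriv_eval_form,
    lieDeriv_eval_form]
  have e1 := mul_eval_derivative_X_pow k.natAbs (planeForm k x)
  have h1 : heightForm (gen 2 x) = 0 := by simp [heightForm_apply, gen_two]
  set ε : ℂ := ((if 0 ≤ k then 1 else -1 : ℝ) : ℂ) with hε
  have hε2 : ε ^ 2 = 1 := by rw [hε]; split_ifs <;> simp
  have h2 : planeForm k (gen 2 x) = ε * Complex.I * planeForm k x := by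
    simp only [planeForm_apply, gen_two, ← hε]
    simp
    linear_combination (-(x 1 : ℂ)) * ε ^ 2 * Complex.I_sq + (x 1 : ℂ) * hε2
  have h3 : (k : ℂ) = ε * k.natAbs := by
    rw [hε]
    split_ifs with h
    · conv_lhs => rw [← Int.natAbs_of_nonneg h]
      push_cast; simp
    · have : k = -(k.natAbs : ℤ) := by omega
      conv_lhs => rw [this]
      push_cast; simp
  rw [h1, h2, h3]
  linear_combination ε * Complex.I * eval (heightForm x) p * e1

/-- Triangularity on monomials. For n < 2 the truncated exponent n - 2 is harmless because its
coefficient vanishes. -/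
theorem legendreOp_X_pow (a n : ℕ) :
    legendreOp a (X ^ n) = (n * (n - 1) : ℂ) • X ^ (n - 2) - (lam (a + n) : ℂ) • X ^ n := by
  rw [legendreOp_apply]
  have hl : (lam (a + n) : ℂ) = (a + n) * (a + n + 1) := by simp [lam]
  rw [hl]
  have h2 : (C 2 : ℂ[X]) = 2 := rfl
  rcases n with _ | _ | n
  · simp
  · simp [smul_eq_C_mul, h2]
    ring
  · simp [smul_eq_C_mul, h2]
    ring

theorem lam_strictMono : StrictMono lam := by
  intro m n h
  have h' : (m : ℝ) + 1 ≤ n := by exact_mod_cast h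
  have : (0 : ℝ) ≤ m := Nat.cast_nonneg m
  unfold lam
  nlinarith

theorem lam_pos {n : ℕ} (h : 0 < n) : 0 < lam n := by
  have := lam_strictMono h
  simpa [lam] using this

theorem X_pow_sub_two_mem_degreeLT (n : ℕ) :
    (n * (n - 1) : ℂ) • (X ^ (n - 2) : ℂ[X]) ∈ degreeLT ℂ n := by
  rcases n with _ | n
  · simp
  · refine Submodule.smul_mem _ _ (mem_degreeLT.2 ?_)
    rw [degree_X_pow]
    exact_mod_cast (by omega : n + 1 - 2 < n + 1)

/-- A triangular system with diagonal entries μ - λ_{a+m}, all nonzero: the top coefficient is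
removed first, and induction solves the rest. -/
theorem exists_legendreOp_add_smul_eq (a : ℕ) (μ : ℂ) (n : ℕ) (hμ : ∀ m < n, μ ≠ lam (a + m)) :
    ∀ q ∈ degreeLT ℂ n, ∃ r ∈ degreeLT ℂ n, legendreOp a r + μ • r = q := by
  induction n with
  | zero =>
    intro q hq
    refine ⟨0, zero_mem _, ?_⟩
    have : q = 0 := by simpa [mem_degreeLT, Nat.WithBot.lt_zero_iff] using hq
    simp [this]
  | succ n ih =>
    intro q hq
    have hne : μ - lam (a + n) ≠ 0 := sub_ne_zero.2 (hμ n (Nat.lt_succ_self n))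
    set d : ℂ := q.coeff n / (μ - lam (a + n)) with hd
    have hq' : q - q.coeff n • X ^ n ∈ degreeLT ℂ n := by
      rw [mem_degreeLT, degree_lt_iff_coeff_zero]
      intro m hm
      rcases hm.eq_or_lt with rfl | hm
      · simp
      · rw [mem_degreeLT, degree_lt_iff_coeff_zero] at hq
        simp [hq m hm, coeff_X_pow, hm.ne']
    obtain ⟨r, hr, hr'⟩ := ih (fun m hm => hμ m (hm.trans (Nat.lt_succ_self n))) _
      (sub_mem hq' (Submodule.smul_mem _ d (X_pow_sub_two_mem_degreeLT n)))
    refine ⟨r + d • X ^ n, add_mem (degreeLT_mono (Nat.le_succ n) hr) (Submodule.smul_mem _ _ ?_), ?_⟩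
    · rw [mem_degreeLT, degree_X_pow]
      exact_mod_cast Nat.lt_succ_self n
    · have e : d * (μ - lam (a + n)) = q.coeff n := div_mul_cancel₀ _ hne
      rw [map_add, map_smul, legendreOp_X_pow]
      have : legendreOp a r = q - q.coeff n • X ^ n - d • (n * (n - 1) : ℂ) • X ^ (n - 2) - μ • r := by
        rw [← hr']; abel
      rw [this, ← e]
      module

/-- Eigenpolynomials of `legendreOp a`, one in each degree. -/
theorem exists_eigenpolynomials (a : ℕ) : ∃ S : Polynomial.Sequence ℂ,
    ∀ n, legendreOp a (S n) = -(lam (a + n) : ℂ) • S n := by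
  have key : ∀ n : ℕ, ∃ p : ℂ[X], p.degree = n ∧ legendreOp a p = -(lam (a + n) : ℂ) • p := by
    intro n
    -- The eigenpolynomial is Xⁿ - r, with r cancelling the lower-order term; strict monotonicity of
    -- `lam` keeps μ = λ_{a+n} off the lower diagonal entries.
    obtain ⟨r, hr, hr'⟩ := exists_legendreOp_add_smul_eq a (lam (a + n)) n (by
      intro m hm h
      have := lam_strictMono.injective (Complex.ofReal_injective h)
      omega) _ (X_pow_sub_two_mem_degreeLT n)
    refine ⟨X ^ n - r, ?_, ?_⟩
    · rw [degree_sub_eq_left_of_degree_lt, degree_X_pow]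
      rw [degree_X_pow]
      exact mem_degreeLT.1 hr
    · rw [map_sub, legendreOp_X_pow, ← hr']
      module
  choose p hp hp' using key
  exact ⟨⟨p, hp⟩, hp'⟩

/-! ### The bilinear pairing on L² and density of the weight functions -/

/-- The class in `L²` of a continuous function. -/
noncomputable def toL2 : C(S2, ℂ) →L[ℂ] L2S := ContinuousMap.toLp 2 surf ℂ

/-- Multiplication by continuous functions on `L²`. -/
noncomputable def mulL : C(S2, ℂ) →L[ℂ] L2S →L[ℂ] L2S :=
  (ContinuousLinearMap.holderL surf ⊤ 2 2 (ContinuousLinearMap.mul ℂ ℂ)).comp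
    (ContinuousMap.toLp ⊤ surf ℂ)

theorem coeFn_toL2 (g : C(S2, ℂ)) : toL2 g =ᵐ[surf] g := ContinuousMap.coeFn_toLp surf g

theorem coeFn_mulL (g : C(S2, ℂ)) (f : L2S) : ∀ᵐ x ∂surf, mulL g f x = g x * f x := by
  have h1 := ContinuousLinearMap.coeFn_holder (r := 2) (ContinuousLinearMap.mul ℂ ℂ)
    (ContinuousMap.toLp ⊤ surf ℂ g) f
  filter_upwards [h1, ContinuousMap.coeFn_toLp (p := ⊤) (𝕜 := ℂ) surf g] with x hx hx'
  simp only [hx', ContinuousLinearMap.mul_apply'] at hx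
  exact hx

/-- The bilinear pairing `(g, f) ↦ ∫ f g`. -/
noncomputable def pairing : C(S2, ℂ) →L[ℂ] L2S →L[ℂ] ℂ :=
  (ContinuousLinearMap.compL ℂ L2S L2S ℂ (innerSL ℂ (toL2 1))).comp mulL

theorem pairing_apply (g : C(S2, ℂ)) (f : L2S) : pairing g f = ∫ x, f x * g x ∂surf := by
  change inner ℂ (toL2 1) (mulL g f) = _
  rw [L2.inner_def]
  refine integral_congr_ae ?_
  filter_upwards [coeFn_toL2 1, coeFn_mulL g f] with x h1 h2
  simp [h1, h2, mul_comm]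

theorem pairing_mulL (g h : C(S2, ℂ)) (f : L2S) : pairing g (mulL h f) = pairing (h * g) f := by
  simp only [pairing_apply]
  refine integral_congr_ae ?_
  filter_upwards [coeFn_mulL h f] with x h1
  simp only [h1, ContinuousMap.mul_apply]
  ring

theorem inner_toL2 (g : C(S2, ℂ)) (f : L2S) : inner ℂ (toL2 g) f = pairing (star g) f := by
  rw [pairing_apply, L2.inner_def]
  refine integral_congr_ae ?_
  filter_upwards [coeFn_toL2 g] with x h1
  simp [h1]

/-- Restriction of a smooth function to the sphere. -/
noncomputable def restr (φ : E3 → ℂ) (hφ : ContDiff ℝ ∞ φ) : C(S2, ℂ) :=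
  ⟨fun x => φ x, hφ.continuous.comp continuous_subtype_val⟩

/-- The restriction of `weightFun k p` to the sphere. -/
noncomputable def weightMap (k : ℤ) : ℂ[X] →ₗ[ℂ] C(S2, ℂ) where
  toFun p := restr (weightFun k p) (contDiff_weightFun k p)
  map_add' p q := by
    ext x
    simp [restr, weightFun, mul_add]
  map_smul' c p := by
    ext x
    simp only [restr, weightFun, eval_smul, ContinuousMap.coe_mk, RingHom.id_apply,
      ContinuousMap.smul_apply, smul_eq_mul]
    ring

theorem weightMap_apply (k : ℤ) (p : ℂ[X]) (x : S2) : weightMap k p x = weightFun k p x := rfl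

theorem eval_planeForm (k : ℤ) (y : E3) : (X ^ k.natAbs : ℂ[X]).eval (planeForm k y) =
    (y 0 + Complex.I * y 1 : ℂ) ^ k.toNat * (y 0 - Complex.I * y 1 : ℂ) ^ (-k).toNat := by
  rw [eval_pow, eval_X, planeForm_apply]
  rcases le_or_gt 0 k with h | h
  · rw [if_pos h, show k.natAbs = k.toNat by omega, show (-k).toNat = 0 by omega]
    simp
  · rw [if_neg (by omega), show k.natAbs = (-k).toNat by omega, show k.toNat = 0 by omega]
    simp [sub_eq_add_neg]

/-- On the sphere (x₀ + i x₁)(x₀ - i x₁) = 1 - x₂². When the signs of j and k differ, the exponent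
counts the conjugate pairs that merge; otherwise it is zero. -/
theorem weightMap_mul (j k : ℤ) (p q : ℂ[X]) : weightMap j p * weightMap k q =
    weightMap (j + k) ((1 - X ^ 2) ^ (j.toNat + k.toNat - (j + k).toNat) * p * q) := by
  ext x
  simp only [ContinuousMap.mul_apply, weightMap_apply, weightFun, eval_planeForm, eval_mul]
  set m := j.toNat + k.toNat - (j + k).toNat with hm
  have h1 : (1 - X ^ 2 : ℂ[X]).eval (heightForm x) =
      ((x : E3) 0 + Complex.I * (x : E3) 1 : ℂ) * ((x : E3) 0 - Complex.I * (x : E3) 1 : ℂ) := by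
    simp only [eval_sub, eval_one, eval_pow, eval_X, heightForm_apply]
    linear_combination -sum_sq_coord x + ((x : E3) 1 : ℂ) ^ 2 * Complex.I_sq
  rw [eval_pow, h1]
  generalize ((x : E3) 0 + Complex.I * (x : E3) 1 : ℂ) = z
  generalize ((x : E3) 0 - Complex.I * (x : E3) 1 : ℂ) = w
  have h2 : z ^ j.toNat * z ^ k.toNat = z ^ m * z ^ (j + k).toNat := by
    rw [← pow_add, ← pow_add]; congr 1; omega
  have h3 : w ^ (-j).toNat * w ^ (-k).toNat = w ^ m * w ^ (-(j + k)).toNat := by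
    rw [← pow_add, ← pow_add]; congr 1; omega
  rw [mul_pow]
  linear_combination (eval (heightForm x) p * eval (heightForm x) q) *
    (w ^ (-j).toNat * w ^ (-k).toNat * h2 + z ^ m * z ^ (j + k).toNat * h3)

theorem star_weightMap (k : ℤ) (p : ℂ[X]) :
    star (weightMap k p) = weightMap (-k) (p.map (starRingEnd ℂ)) := by
  ext x
  simp only [ContinuousMap.star_apply, weightMap_apply, weightFun, eval_planeForm, neg_neg]
  have : eval (heightForm x) (p.map (starRingEnd ℂ)) = starRingEnd ℂ (eval (heightForm x) p) := by
    have h : heightForm x = starRingEnd ℂ (heightForm x) := by simp [heightForm_apply]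
    conv_lhs => rw [h]
    rw [eval_map, eval₂_at_apply]
  rw [this]
  simp
  left
  ring

/-- The span of the functions of all weights. -/
noncomputable def weightSpan : Submodule ℂ C(S2, ℂ) :=
  Submodule.span ℂ {g | ∃ k p, weightMap k p = g}

theorem weightMap_mem_weightSpan (k : ℤ) (p : ℂ[X]) : weightMap k p ∈ weightSpan :=
  Submodule.subset_span ⟨k, p, rfl⟩

theorem one_mem_weightSpan : 1 ∈ weightSpan := by
  convert weightMap_mem_weightSpan 0 1
  ext x
  simp [weightMap_apply, weightFun]

theorem mul_mem_weightSpan {f g : C(S2, ℂ)} (hf : f ∈ weightSpan) (hg : g ∈ weightSpan) :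
    f * g ∈ weightSpan := by
  have h := Submodule.mul_mem_mul hf hg
  rw [weightSpan, Submodule.span_mul_span] at h
  refine Submodule.span_le.2 ?_ h
  rintro _ ⟨_, ⟨j, p, rfl⟩, _, ⟨k, q, rfl⟩, rfl⟩
  simp only [weightMap_mul]
  exact weightMap_mem_weightSpan _ _

theorem star_mem_weightSpan {f : C(S2, ℂ)} (hf : f ∈ weightSpan) : star f ∈ weightSpan := by
  induction hf using Submodule.span_induction with
  | mem x h =>
    obtain ⟨k, p, rfl⟩ := h
    rw [star_weightMap]
    exact weightMap_mem_weightSpan _ _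
  | zero => simp
  | add x y _ _ hx hy =>
    rw [star_add]
    exact add_mem hx hy
  | smul a x _ hx =>
    rw [star_smul]
    exact Submodule.smul_mem _ _ hx

/-- `weightSpan` as a star subalgebra. -/
noncomputable def weightAlgebra : StarSubalgebra ℂ C(S2, ℂ) where
  toSubalgebra := weightSpan.toSubalgebra one_mem_weightSpan fun _ _ => mul_mem_weightSpan
  star_mem' := star_mem_weightSpan

theorem dense_weightSpan : Dense (weightSpan : Set C(S2, ℂ)) := by
  have h : weightAlgebra.topologicalClosure = ⊤ := by
    apply ContinuousMap.starSubalgebra_topologicalClosure_eq_top_of_separatesPoints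
    intro x y hxy
    by_contra! hcon
    -- The functions x₀ + i x₁ and x₂ already separate points.
    have h1 := hcon _ ⟨weightMap 1 1, weightMap_mem_weightSpan 1 1, rfl⟩
    have h2 := hcon _ ⟨weightMap 0 X, weightMap_mem_weightSpan 0 X, rfl⟩
    simp only [weightMap_apply, weightFun, eval_planeForm, heightForm_apply] at h1 h2
    simp at h1 h2
    apply hxy
    have h3 := congrArg Complex.re h1
    have h4 := congrArg Complex.im h1
    simp at h3 h4
    ext i
    fin_cases i
    exacts [h3, h4, h2]
  rw [dense_iff_closure_eq]
  have h' := congrArg (fun A : StarSubalgebra ℂ C(S2, ℂ) => (A : Set C(S2, ℂ))) h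
  rw [StarSubalgebra.topologicalClosure_coe] at h'
  exact h'

theorem eq_zero_of_pairing_weightMap {f : L2S} (h : ∀ k p, pairing (weightMap k p) f = 0) :
    f = 0 := by
  have h1 : pairing.flip f = 0 := by
    refine ContinuousLinearMap.ext_on dense_weightSpan ?_
    rintro _ ⟨k, p, rfl⟩
    exact h k p
  have h2 : DenseRange toL2 := ContinuousMap.toLp_denseRange ℂ surf ℂ (by simp)
  have h3 : ∀ v, inner ℂ v f = 0 := by
    intro v
    refine h2.induction_on v ?_ ?_
    · exact isClosed_eq (by fun_prop) continuous_const
    · intro g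
      rw [inner_toL2]
      exact congrArg (fun T => T (star g)) h1
  exact inner_self_eq_zero.1 (h3 f)

/-! ### Operators on a Hilbert space: diagonal operators and criteria for real spectrum -/

section Abstract
open Filter Topology

variable {ι H : Type*} [NormedAddCommGroup H] [InnerProductSpace ℂ H]

/-- Diagonal operators with respect to a Hilbert basis. -/
theorem exists_repr_eq_mul (b : HilbertBasis ι ℂ H) (d : ι → ℝ) (C : ℝ)
    (hd : ∀ i, |d i| ≤ C) :
    ∃ K : H →L[ℂ] H, ∀ x i, b.repr (K x) i = d i * b.repr x i := by
  rcases isEmpty_or_nonempty ι with hι | ⟨⟨i₀⟩⟩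
  · exact ⟨0, fun x i => hι.elim i⟩
  have hC : 0 ≤ C := (abs_nonneg _).trans (hd i₀)
  have hle : ∀ (y : lp (fun _ : ι => ℂ) 2) (i : ι),
      ‖(d i : ℂ) * y i‖ ^ (2 : ENNReal).toReal ≤ C ^ 2 * ‖y i‖ ^ (2 : ENNReal).toReal := by
    intro y i
    simp only [ENNReal.toReal_ofNat, Real.rpow_ofNat, norm_mul, Complex.norm_real,
      Real.norm_eq_abs, mul_pow]
    gcongr
    exact hd i
  have hmem : ∀ y : lp (fun _ : ι => ℂ) 2, Memℓp (fun i => (d i : ℂ) * y i) 2 := fun y =>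
    memℓp_gen (Summable.of_nonneg_of_le (fun i => by positivity) (hle y)
      (((lp.memℓp y).summable (by simp)).mul_left _))
  let T : lp (fun _ : ι => ℂ) 2 →ₗ[ℂ] lp (fun _ : ι => ℂ) 2 :=
    { toFun := fun y => ⟨fun i => (d i : ℂ) * y i, hmem y⟩
      map_add' := by
        intro x y
        ext i
        exact mul_add _ _ _
      map_smul' := by
        intro c y
        ext i
        simp [mul_left_comm] }
  have hT : ∀ y, ‖T y‖ ≤ C * ‖y‖ := by
    intro y
    refine lp.norm_le_of_tsum_le (by simp) (by positivity) ?_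
    have hs := (lp.memℓp y).summable (p := 2) (by simp)
    calc ∑' i, ‖T y i‖ ^ (2 : ENNReal).toReal
        ≤ ∑' i, C ^ 2 * ‖y i‖ ^ (2 : ENNReal).toReal :=
          Summable.tsum_le_tsum (hle y) ((hmem y).summable (by simp)) (hs.mul_left _)
      _ = (C * ‖y‖) ^ (2 : ENNReal).toReal := by
          rw [tsum_mul_left, ← lp.norm_rpow_eq_tsum (by simp)]
          simp [mul_pow]
  refine ⟨(b.repr.symm : _ →L[ℂ] H) ∘L (T.mkContinuous C hT) ∘L (b.repr : H →L[ℂ] _), ?_⟩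
  intro x i
  simp [T]

theorem re_inner_self {E : Type*} [NormedAddCommGroup E] [InnerProductSpace ℂ E] (v : E) :
    (inner ℂ v v).re = ‖v‖ ^ 2 := by
  rw [inner_self_eq_norm_sq_to_K]
  norm_cast

/-- A diagonal operator with real nonpositive coefficients `d i`, `|d i| ≤ κ⁻¹`. -/
theorem exists_diagonal (b : HilbertBasis ι ℂ H) (d : ι → ℝ) {κ : ℝ} (hκ : 0 < κ)
    (hd : ∀ i, κ * d i ^ 2 ≤ -d i) :
    ∃ K : H →L[ℂ] H, (∀ i, K (b i) = (d i : ℂ) • b i) ∧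
      (∀ x y, inner ℂ (K x) y = inner ℂ x (K y)) ∧
      ∀ x, κ * ‖K x‖ ^ 2 ≤ -(inner ℂ (K x) x).re := by
  classical
  obtain ⟨K, hK⟩ := exists_repr_eq_mul b d κ⁻¹ (by
    intro i
    have h0 : d i ≤ 0 := by nlinarith [hd i, sq_nonneg (d i)]
    rw [abs_of_nonpos h0, ← mul_le_mul_iff_right₀ hκ, mul_inv_cancel₀ hκ.ne']
    rcases h0.eq_or_lt with h | h
    · simp [h]
    · nlinarith [hd i])
  refine ⟨K, ?_, ?_, ?_⟩
  · intro i
    apply b.repr.injective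
    ext j
    rw [hK, map_smul, lp.coeFn_smul, Pi.smul_apply, smul_eq_mul, b.repr_self]
    by_cases h : j = i
    · rw [h]
    · simp [h]
  · intro x y
    rw [← b.repr.inner_map_map, ← b.repr.inner_map_map, lp.inner_eq_tsum, lp.inner_eq_tsum]
    refine tsum_congr fun i => ?_
    rw [hK, hK]
    simp
    ring
  · intro x
    have h1 := Complex.reCLM.hasSum (lp.hasSum_inner (𝕜 := ℂ) (b.repr (K x)) (b.repr (K x)))
    have h2 := Complex.reCLM.hasSum (lp.hasSum_inner (𝕜 := ℂ) (b.repr (K x)) (b.repr x))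
    rw [b.repr.inner_map_map] at h1 h2
    rw [← re_inner_self (K x)]
    refine hasSum_le ?_ (h1.mul_left κ) h2.neg
    intro i
    have e1 : (inner ℂ (b.repr (K x) i) (b.repr (K x) i)).re = d i ^ 2 * ‖b.repr x i‖ ^ 2 := by
      rw [re_inner_self, hK, norm_mul, mul_pow]
      simp
    have e2 : (inner ℂ (b.repr (K x) i) (b.repr x i)).re = d i * ‖b.repr x i‖ ^ 2 := by
      rw [hK, ← smul_eq_mul, inner_smul_left, Complex.conj_ofReal, Complex.re_ofReal_mul,
        re_inner_self]
    simp only [Complex.reCLM_apply, e1, e2]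
    nlinarith [hd i, sq_nonneg ‖b.repr x i‖]

/-- Lets the criteria below argue with limits along Weyl sequences: if every bound fails, normalised
witnesses for c = 1/(n+1) form one. -/
theorem exists_bounded_below_of_seq (T : H →L[ℂ] H)
    (h : ∀ x : ℕ → H, (∀ n, ‖x n‖ = 1) → ¬ Tendsto (fun n => T (x n)) atTop (𝓝 0)) :
    ∃ c > 0, ∀ x, c * ‖x‖ ≤ ‖T x‖ := by
  by_contra! hcon
  have h1 : ∀ n : ℕ, ∃ x : H, ‖x‖ = 1 ∧ ‖T x‖ ≤ 1 / (n + 1 : ℝ) := by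
    intro n
    obtain ⟨x, hx⟩ := hcon (1 / (n + 1 : ℝ)) (by positivity)
    have hx0 : 0 < ‖x‖ := by
      by_contra h0
      have : ‖x‖ = 0 := le_antisymm (not_lt.1 h0) (norm_nonneg _)
      rw [this, mul_zero] at hx
      exact absurd hx (not_lt.2 (norm_nonneg _))
    refine ⟨((‖x‖⁻¹ : ℝ) : ℂ) • x, ?_, ?_⟩
    · rw [norm_smul, Complex.norm_real, norm_inv, norm_norm, inv_mul_cancel₀ hx0.ne']
    · rw [map_smul, norm_smul, Complex.norm_real, norm_inv, norm_norm, inv_mul_le_iff₀ hx0]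
      linarith
  choose x hx hx' using h1
  refine h x hx (squeeze_zero_norm hx' tendsto_one_div_add_atTop_nhds_zero_nat)

variable [CompleteSpace H]

/-- The spectrum of `M` is real if no non-real number is an approximate eigenvalue: a point of the
spectrum with the largest imaginary part in modulus is an approximate eigenvalue. -/
theorem spectrum_subset_real_of_bounded_below (M : H →L[ℂ] H)
    (hM : ∀ z : ℂ, z.im ≠ 0 → ∃ c > 0, ∀ x, c * ‖x‖ ≤ ‖M x - z • x‖) :
    spectrum ℂ M ⊆ Set.range (fun r : ℝ => (r : ℂ)) := by
  by_contra hcon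
  obtain ⟨z, hz, hzr⟩ := Set.not_subset.1 hcon
  have hz0 : z.im ≠ 0 := fun h => hzr ⟨z.re, Complex.ext (by simp) (by simp [h])⟩
  obtain ⟨w, hw, hmax⟩ := (spectrum.isCompact M).exists_isMaxOn ⟨z, hz⟩
    (f := fun z : ℂ => |z.im|) (by fun_prop)
  have hw0 : w.im ≠ 0 := by
    have : |z.im| ≤ |w.im| := hmax hz
    exact abs_pos.1 ((abs_pos.2 hz0).trans_le this)
  obtain ⟨c, hc, hcM⟩ := hM w hw0
  -- The sign pushes `w'` away from the real axis and so out of the spectrum. The size c/3 leaves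
  -- the lower bound 2c/3 at `w'`, so the Neumann series back to `w` has ratio at most 1/2.
  set δ : ℝ := SignType.sign w.im * (c / 3) with hδ
  have hδabs : |δ| = c / 3 := by
    rw [hδ, abs_mul, abs_of_pos (by positivity : 0 < c / 3)]
    rcases hw0.lt_or_gt with h | h <;> simp [h]
  set w' : ℂ := w + δ * Complex.I with hw'
  have hw'im : |w.im| < |w'.im| := by
    have : w'.im = w.im + δ := by simp [hw']
    rw [this]
    rcases hw0.lt_or_gt with h | h
    · rw [hδ, sign_neg h, abs_of_neg h, abs_of_neg] <;> simp <;> linarith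
    · rw [hδ, sign_pos h, abs_of_pos h, abs_of_pos] <;> simp <;> linarith
  have hns : w' ∉ spectrum ℂ M := fun h => absurd (hmax h) (not_le.2 hw'im)
  rw [spectrum.notMem_iff] at hns
  obtain ⟨u, hu⟩ := hns
  have hinv : ‖(↑u⁻¹ : H →L[ℂ] H)‖ ≤ (c * 2 / 3)⁻¹ := by
    refine ContinuousLinearMap.opNorm_le_bound _ (by positivity) fun y => ?_
    set x := (↑u⁻¹ : H →L[ℂ] H) y with hx
    have hy : (u : H →L[ℂ] H) x = y := by
      rw [hx, ← mul_apply_eq_comp, u.mul_inv, one_apply_eq_self]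
    have hy' : y = -(M x - w • x) + (δ * Complex.I) • x := by
      rw [← hy, hu, hw']
      simp only [sub_apply, Algebra.algebraMap_eq_smul_one, smul_apply, one_apply_eq_self]
      module
    have h1 : ‖M x - w • x‖ ≤ ‖y‖ + c / 3 * ‖x‖ := by
      calc ‖M x - w • x‖ = ‖(δ * Complex.I) • x - y‖ := by
            rw [hy']; congr 1; abel
        _ ≤ ‖(δ * Complex.I) • x‖ + ‖y‖ := norm_sub_le _ _
        _ = ‖y‖ + c / 3 * ‖x‖ := by
            rw [norm_smul, norm_mul, Complex.norm_I, Complex.norm_real, Real.norm_eq_abs, hδabs,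
              mul_one, add_comm]
    have h2 := hcM x
    rw [inv_mul_eq_div, le_div_iff₀ (by positivity)]
    linarith
  apply hw
  have e : algebraMap ℂ (H →L[ℂ] H) w - M =
      u * (1 - ↑u⁻¹ * ((δ * Complex.I) • 1)) := by
    rw [mul_sub, mul_one, ← mul_assoc, u.mul_inv, one_mul, hu, hw']
    simp only [Algebra.algebraMap_eq_smul_one]
    module
  change IsUnit _
  rw [e]
  refine u.isUnit.mul (isUnit_one_sub_of_norm_lt_one ?_)
  calc ‖(↑u⁻¹ : H →L[ℂ] H) * ((δ * Complex.I) • 1)‖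
      = ‖(δ * Complex.I) • (↑u⁻¹ : H →L[ℂ] H)‖ := by rw [mul_smul_comm, mul_one]
    _ ≤ c / 3 * (c * 2 / 3)⁻¹ := by
        rw [norm_smul, norm_mul, Complex.norm_I, Complex.norm_real, Real.norm_eq_abs, hδabs,
          mul_one]
        gcongr
    _ < 1 := by
        rw [← div_eq_mul_inv, div_lt_one (by positivity)]
        linarith

theorem exists_inverse_sub_smul {A : H →L[ℂ] H} (hA : ∀ x y, inner ℂ (A x) y = inner ℂ x (A y))
    {z : ℂ} (hz : z.im ≠ 0) :
    ∃ R : H →L[ℂ] H, (∀ x, A (R x) - z • R x = x) ∧ ∀ x, R (A x - z • x) = x := by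
  have hsa : IsSelfAdjoint A := by
    rw [ContinuousLinearMap.isSelfAdjoint_iff_isSymmetric]
    exact hA
  have hns : z ∉ spectrum ℂ A := fun h => hz (by
    have := hsa.mem_spectrum_eq_re h
    rw [this]; simp)
  rw [spectrum.notMem_iff] at hns
  obtain ⟨u, hu⟩ := hns
  have hv : ∀ x, A x - z • x = -(u : H →L[ℂ] H) x := by
    intro x
    rw [hu]
    simp [Algebra.algebraMap_eq_smul_one]
  refine ⟨-(↑u⁻¹ : H →L[ℂ] H), fun x => ?_, fun x => ?_⟩
  · rw [hv, neg_apply, map_neg, neg_neg, ← mul_apply_eq_comp, u.mul_inv, one_apply_eq_self]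
  · rw [hv, neg_apply, map_neg, neg_neg, ← mul_apply_eq_comp, u.inv_mul, one_apply_eq_self]

end Abstract

section Abstract
open Filter Topology

variable {H : Type*} [NormedAddCommGroup H] [InnerProductSpace ℂ H]

theorem im_inner_self_eq_zero_of_symmetric {K : H →L[ℂ] H}
    (hK : ∀ x y, inner ℂ (K x) y = inner ℂ x (K y)) (x : H) : (inner ℂ (K x) x).im = 0 := by
  rw [← Complex.conj_eq_iff_im, inner_conj_symm, hK]

variable [CompleteSpace H]

/-- A Weyl sequence of `A + B K` at a non-real number `z`, for commuting symmetric `A`, `B` and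
symmetric `K`: with `K ζₙ = (A - z) uₙ`, one has `ζₙ + B uₙ → 0` and `⟪uₙ, B uₙ⟫ → 0`. -/
theorem exists_seq_of_approx_eigenvector {A B K : H →L[ℂ] H}
    (hA : ∀ x y, inner ℂ (A x) y = inner ℂ x (A y))
    (hB : ∀ x y, inner ℂ (B x) y = inner ℂ x (B y))
    (hAB : ∀ x, A (B x) = B (A x)) (hK : ∀ x y, inner ℂ (K x) y = inner ℂ x (K y))
    {z : ℂ} (hz : z.im ≠ 0) {ζ : ℕ → H} (hζ : ∀ n, ‖ζ n‖ = 1)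
    (h : Tendsto (fun n => A (ζ n) + B (K (ζ n)) - z • ζ n) atTop (𝓝 0)) :
    ∃ u : ℕ → H, Tendsto (fun n => ζ n + B (u n)) atTop (𝓝 0) ∧
      Tendsto (fun n => (inner ℂ (u n) (B (u n))).re) atTop (𝓝 0) ∧
      Tendsto (fun n => (inner ℂ (K (ζ n)) (ζ n)).re + (inner ℂ (A (u n)) (B (u n))).re) atTop
        (𝓝 0) := by
  obtain ⟨R, hR, hR'⟩ := exists_inverse_sub_smul hA hz
  set s : ℕ → H := fun n => R (A (ζ n) + B (K (ζ n)) - z • ζ n) with hs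
  have hs0 : Tendsto s atTop (𝓝 0) := by
    have := (R.continuous.tendsto 0).comp h
    rw [map_zero] at this
    exact this
  set u : ℕ → H := fun n => R (K (ζ n))
  have hKu : ∀ n, K (ζ n) = A (u n) - z • u n := fun n => (hR _).symm
  -- As `A` and `B` commute, (A - z)(ζ + B u) is exactly the residual of the approximate eigenvector
  -- equation.
  have hsu : ∀ n, ζ n + B (u n) = s n := by
    intro n
    rw [← hR' (ζ n + B (u n))]
    simp only [hs]
    congr 1
    rw [map_add, hKu n, map_sub, map_smul, hAB]
    module
  have hKs : Tendsto (fun n => inner ℂ (K (ζ n)) (s n)) atTop (𝓝 0) := by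
    refine squeeze_zero_norm (a := fun n => ‖K‖ * ‖s n‖) (fun n => ?_) ?_
    · refine (norm_inner_le_norm _ _).trans ?_
      gcongr
      simpa [hζ n] using K.le_opNorm (ζ n)
    · simpa using hs0.norm.const_mul ‖K‖
  have him1 : ∀ n, (inner ℂ (A (u n)) (B (u n))).im = 0 := by
    intro n
    rw [← Complex.conj_eq_iff_im, inner_conj_symm, hB, ← hAB, hA]
  have him2 : ∀ n, (inner ℂ (u n) (B (u n))).im = 0 := fun n => by
    rw [← hB]; exact im_inner_self_eq_zero_of_symmetric hB _
  -- Pair K ζ with ζ = s - B u, writing K ζ = (A - z) u in the second term.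
  have key : ∀ n, inner ℂ (K (ζ n)) (ζ n) = -inner ℂ (A (u n)) (B (u n)) +
      (starRingEnd ℂ) z * inner ℂ (u n) (B (u n)) + inner ℂ (K (ζ n)) (s n) := by
    intro n
    have : ζ n = s n - B (u n) := by rw [← hsu n]; abel
    have h1 : inner ℂ (K (ζ n)) (ζ n) =
        inner ℂ (K (ζ n)) (s n) - inner ℂ (K (ζ n)) (B (u n)) := by
      rw [← inner_sub_right, ← this]
    have h2 : inner ℂ (K (ζ n)) (B (u n)) =
        inner ℂ (A (u n)) (B (u n)) - (starRingEnd ℂ) z * inner ℂ (u n) (B (u n)) := by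
      rw [hKu n, inner_sub_left, inner_smul_left]
    rw [h1, h2]
    ring
  -- Taking imaginary parts leaves only Im z · ⟨u, Bu⟩ and the error term; this is where Im z ≠ 0 is
  -- needed.
  have hre : ∀ n, (inner ℂ (u n) (B (u n))).re = z.im⁻¹ * (inner ℂ (K (ζ n)) (s n)).im := by
    intro n
    have h1 := congrArg Complex.im (key n)
    rw [im_inner_self_eq_zero_of_symmetric hK] at h1
    simp only [Complex.add_im, Complex.neg_im, Complex.mul_im, him1, him2, Complex.conj_re,
      Complex.conj_im] at h1
    field_simp
    linarith
  have hlim : Tendsto (fun n => (inner ℂ (u n) (B (u n))).re) atTop (𝓝 0) := by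
    simp only [hre]
    simpa using ((Complex.continuous_im.tendsto 0).comp hKs).const_mul z.im⁻¹
  refine ⟨u, ?_, hlim, ?_⟩
  · simpa only [hsu] using hs0
  · have h2 : ∀ n, (inner ℂ (K (ζ n)) (ζ n)).re + (inner ℂ (A (u n)) (B (u n))).re =
        z.re * (inner ℂ (u n) (B (u n))).re + (inner ℂ (K (ζ n)) (s n)).re := by
      intro n
      have h1 := congrArg Complex.re (key n)
      simp only [Complex.add_re, Complex.neg_re, Complex.mul_re, him2, Complex.conj_re] at h1
      linarith
    simp only [h2]
    simpa using (hlim.const_mul z.re).add ((Complex.continuous_re.tendsto 0).comp hKs)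

/-- Rayleigh's criterion. -/
theorem spectrum_subset_real_of_definite {A B K : H →L[ℂ] H}
    (hA : ∀ x y, inner ℂ (A x) y = inner ℂ x (A y))
    (hB : ∀ x y, inner ℂ (B x) y = inner ℂ x (B y))
    (hAB : ∀ x, A (B x) = B (A x)) (hK : ∀ x y, inner ℂ (K x) y = inner ℂ x (K y))
    {C : ℝ} (hC : ∀ x, ‖B x‖ ^ 2 ≤ C * |(inner ℂ x (B x)).re|) :
    spectrum ℂ (A + B ∘L K) ⊆ Set.range (fun r : ℝ => (r : ℂ)) := by
  refine spectrum_subset_real_of_bounded_below _ fun z hz => ?_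
  refine exists_bounded_below_of_seq (A + B ∘L K - z • ContinuousLinearMap.id ℂ H) fun ζ hζ h => ?_
  obtain ⟨u, h1, h2, -⟩ := exists_seq_of_approx_eigenvector hA hB hAB hK hz hζ h
  have h3 : Tendsto (fun n => ‖B (u n)‖ ^ 2) atTop (𝓝 0) :=
    squeeze_zero (fun n => by positivity) (fun n => hC (u n)) (by simpa using h2.abs.const_mul C)
  have h4 : Tendsto (fun n => B (u n)) atTop (𝓝 0) := by
    rw [tendsto_zero_iff_norm_tendsto_zero]
    simpa using h3.sqrt
  have h5 := (h1.sub h4).norm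
  simp [hζ] at h5

/-- The criterion for `B = Ω + μ A` with `μ K ≥ -1`. -/
theorem spectrum_subset_real_of_affine {A K : H →L[ℂ] H} {Ω μ κ : ℝ} (hμ : 0 < μ) (hμκ : μ ≤ κ)
    (hA : ∀ x y, inner ℂ (A x) y = inner ℂ x (A y))
    (hK : ∀ x y, inner ℂ (K x) y = inner ℂ x (K y))
    (hKκ : ∀ x, κ * ‖K x‖ ^ 2 ≤ -(inner ℂ (K x) x).re) :
    spectrum ℂ (A + ((Ω : ℂ) • ContinuousLinearMap.id ℂ H + (μ : ℂ) • A) ∘L K) ⊆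
      Set.range (fun r : ℝ => (r : ℂ)) := by
  refine spectrum_subset_real_of_bounded_below _ fun z hz => ?_
  set B : H →L[ℂ] H := (Ω : ℂ) • ContinuousLinearMap.id ℂ H + (μ : ℂ) • A
  have hBx : ∀ x, B x = (Ω : ℂ) • x + (μ : ℂ) • A x := fun x => rfl
  have hB : ∀ x y, inner ℂ (B x) y = inner ℂ x (B y) := by
    intro x y
    simp only [hBx, inner_add_left, inner_add_right, inner_smul_left, inner_smul_right, hA,
      Complex.conj_ofReal]
  refine exists_bounded_below_of_seq (A + B ∘L K - z • ContinuousLinearMap.id ℂ H) fun ζ hζ h => ?_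
  obtain ⟨u, h1, h2, h3⟩ := exists_seq_of_approx_eigenvector hA hB
    (fun x => by simp [hBx]) hK hz hζ h
  have hBu : Tendsto (fun n => ‖B (u n)‖ ^ 2) atTop (𝓝 1) := by
    have h4 : Tendsto (fun n => ‖B (u n)‖) atTop (𝓝 1) := by
      have h5 : Tendsto (fun n => ‖B (u n)‖ - 1) atTop (𝓝 0) := by
        refine squeeze_zero_norm (fun n => ?_) (by simpa using h1.norm)
        have := abs_norm_sub_norm_le (B (u n)) (-ζ n)
        rw [norm_neg, hζ n, sub_neg_eq_add, add_comm] at this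
        exact this
      simpa using h5.add_const 1
    simpa using h4.pow 2
  have hAu : ∀ n, μ * (inner ℂ (A (u n)) (B (u n))).re =
      ‖B (u n)‖ ^ 2 - Ω * (inner ℂ (u n) (B (u n))).re := by
    intro n
    have e : B (u n) = (Ω : ℂ) • u n + (μ : ℂ) • A (u n) := rfl
    have e2 : (inner ℂ (B (u n)) (B (u n))).re =
        Ω * (inner ℂ (u n) (B (u n))).re + μ * (inner ℂ (A (u n)) (B (u n))).re := by
      conv_lhs => rw [show inner ℂ (B (u n)) (B (u n)) =
        inner ℂ ((Ω : ℂ) • u n + (μ : ℂ) • A (u n)) (B (u n)) from by rw [← e]]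
      rw [inner_add_left, inner_smul_left, inner_smul_left, Complex.conj_ofReal,
        Complex.conj_ofReal, Complex.add_re, Complex.re_ofReal_mul, Complex.re_ofReal_mul]
    rw [re_inner_self] at e2
    linarith
  have ht : Tendsto (fun n => μ * (inner ℂ (K (ζ n)) (ζ n)).re) atTop (𝓝 (-1)) := by
    have e : ∀ n, μ * (inner ℂ (K (ζ n)) (ζ n)).re =
        μ * ((inner ℂ (K (ζ n)) (ζ n)).re + (inner ℂ (A (u n)) (B (u n))).re) -
          ‖B (u n)‖ ^ 2 + Ω * (inner ℂ (u n) (B (u n))).re := by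
      intro n
      rw [mul_add, hAu]
      ring
    simp only [e]
    simpa using ((h3.const_mul μ).sub hBu).add (h2.const_mul Ω)
  -- Expanding the square and using κ‖Kζ‖² ≤ -⟨Kζ, ζ⟩ bounds it by 1 + κ⟨Kζ, ζ⟩, whose limit is 1 -
  -- κ/μ ≤ 0.
  have hw : ∀ n, ‖ζ n + (κ : ℂ) • K (ζ n)‖ ^ 2 ≤ 1 + κ / μ * (μ * (inner ℂ (K (ζ n)) (ζ n)).re) := by
    intro n
    have e1 : ‖ζ n + (κ : ℂ) • K (ζ n)‖ ^ 2 =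
        1 + 2 * κ * (inner ℂ (K (ζ n)) (ζ n)).re + κ ^ 2 * ‖K (ζ n)‖ ^ 2 := by
      have := norm_add_sq (𝕜 := ℂ) (ζ n) ((κ : ℂ) • K (ζ n))
      rw [this, hζ n, inner_smul_right, ← hK, norm_smul, mul_pow]
      simp
      ring
    have e2 : κ / μ * (μ * (inner ℂ (K (ζ n)) (ζ n)).re) = κ * (inner ℂ (K (ζ n)) (ζ n)).re := by
      field_simp
    rw [e1, e2]
    nlinarith [mul_le_mul_of_nonneg_left (hKκ (ζ n)) (hμ.le.trans hμκ)]
  have hlim : Tendsto (fun n => 1 + κ / μ * (μ * (inner ℂ (K (ζ n)) (ζ n)).re)) atTop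
      (𝓝 (1 + κ / μ * (-1))) := (ht.const_mul (κ / μ)).const_add 1
  have hκμ : κ = μ := by
    refine le_antisymm ?_ hμκ
    have h0 : 0 ≤ 1 + κ / μ * (-1) :=
      ge_of_tendsto' hlim fun n => (by positivity : (0 : ℝ) ≤ _).trans (hw n)
    have : κ / μ ≤ 1 := by linarith
    rwa [div_le_one hμ] at this
  subst hκμ
  have hw0 : Tendsto (fun n => ζ n + (κ : ℂ) • K (ζ n)) atTop (𝓝 0) := by
    rw [tendsto_zero_iff_norm_tendsto_zero]
    have h0 : Tendsto (fun n => ‖ζ n + (κ : ℂ) • K (ζ n)‖ ^ 2) atTop (𝓝 0) := by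
      refine squeeze_zero (fun n => by positivity) hw ?_
      convert hlim using 2
      rw [div_self hμ.ne']
      norm_num
    simpa using h0.sqrt
  -- In the borderline case κ = μ, substituting K ζ ≈ -ζ/κ cancels the terms with `A`, and only the
  -- scalar κz + Ω, nonzero as z is not real, remains.
  have hfin : Tendsto (fun n => ((κ : ℂ) * z + Ω) • ζ n) atTop (𝓝 0) := by
    have e : ∀ n, ((κ : ℂ) * z + Ω) • ζ n =
        (κ : ℂ) • A (ζ n + (κ : ℂ) • K (ζ n)) + (Ω : ℂ) • (ζ n + (κ : ℂ) • K (ζ n)) -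
          (κ : ℂ) • (A (ζ n) + B (K (ζ n)) - z • ζ n) := by
      intro n
      rw [hBx, map_add, map_smul]
      module
    simp only [e]
    have hA0 := (A.continuous.tendsto 0).comp hw0
    rw [map_zero] at hA0
    simpa using ((hA0.const_smul (κ : ℂ)).add (hw0.const_smul (Ω : ℂ))).sub (h.const_smul (κ : ℂ))
  have hne : (κ : ℂ) * z + Ω ≠ 0 := by
    intro h0
    have := congrArg Complex.im h0
    simp [hμ.ne', hz] at this
  have := hfin.norm
  simp [norm_smul, hζ, hne] at this

end Abstract

/-! ### The weight spaces V k and the inverse Laplacian on them -/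

/-- The Laplacian of a smooth function as a continuous function on the sphere. -/
noncomputable def lapMap (φ : E3 → ℂ) (hφ : ContDiff ℝ ∞ φ) : C(S2, ℂ) :=
  ⟨sphereLaplacian φ, continuous_sphereLaplacian hφ⟩

theorem hasLaplacian_iff {η ζ : L2S} : HasLaplacian η ζ ↔
    ∀ φ (hφ : ContDiff ℝ ∞ φ), pairing (lapMap φ hφ) η = pairing (restr φ hφ) ζ := by
  simp only [pairing_apply]
  rfl

theorem mem_L2b_iff {f : L2S} : f ∈ L2b ↔ pairing 1 f = 0 := by
  rw [pairing_apply]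
  simp only [ContinuousMap.one_apply, mul_one]
  rfl

theorem integral_toL2_mul (g : C(S2, ℂ)) (h : S2 → ℂ) :
    ∫ x, toL2 g x * h x ∂surf = ∫ x, g x * h x ∂surf := by
  refine integral_congr_ae ?_
  filter_upwards [coeFn_toL2 g] with x hx
  rw [hx]

theorem lapMap_weightFun (k : ℤ) (p : ℂ[X]) : lapMap (weightFun k p) (contDiff_weightFun k p) =
    weightMap k (legendreOp k.natAbs p) := by
  ext x
  exact sphereLaplacian_weightFun k p x

theorem hasLaplacian_toL2_weightMap (k : ℤ) (p : ℂ[X]) :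
    HasLaplacian (toL2 (weightMap k p)) (toL2 (weightMap k (legendreOp k.natAbs p))) := by
  intro φ hφ
  rw [integral_toL2_mul, integral_toL2_mul]
  simp only [weightMap_apply]
  rw [integral_mul_sphereLaplacian (contDiff_weightFun k p) hφ]
  simp only [sphereLaplacian_weightFun]

/-- `Δ` is injective on functions of mean zero. -/
theorem eq_zero_of_hasLaplacian_zero {η : L2S} (hη : η ∈ L2b) (h : HasLaplacian η 0) : η = 0 := by
  rw [hasLaplacian_iff] at h
  -- Testing against weight k and Xⁿ expresses λ_{|k|+n} times this moment through the one for n -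
  -- 2. Only k = n = 0 has λ = 0, and there mean zero is used.
  have key : ∀ (k : ℤ) (n : ℕ), pairing (weightMap k (X ^ n)) η = 0 := by
    intro k n
    induction n using Nat.strong_induction_on with
    | _ n ih =>
      rcases Nat.eq_zero_or_pos (k.natAbs + n) with h0 | hpos
      · obtain ⟨hk, rfl⟩ : k = 0 ∧ n = 0 := by omega
        subst hk
        have : weightMap 0 (X ^ 0) = 1 := by
          ext x
          simp [weightMap_apply, weightFun]
        rw [this]
        exact mem_L2b_iff.1 hη
      · have h1 := h _ (contDiff_weightFun k (X ^ n))
        rw [lapMap_weightFun, legendreOp_X_pow, map_zero, map_sub, map_sub, map_smul, map_smul,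
          map_smul, map_smul] at h1
        simp only [sub_apply, smul_apply] at h1
        have h2 : ((n * (n - 1) : ℂ)) • pairing (weightMap k (X ^ (n - 2))) η = 0 := by
          rcases n with _ | n
          · simp
          · rw [ih _ (by omega), smul_zero]
        rw [h2, zero_sub, neg_eq_zero, smul_eq_zero] at h1
        exact h1.resolve_left (by exact_mod_cast (lam_pos hpos).ne')
  refine eq_zero_of_pairing_weightMap fun k p => ?_
  induction p using Polynomial.induction_on' with
  | add p q hp hq => rw [map_add, map_add, add_apply, hp, hq, add_zero]
  | monomial n a =>
    rw [← mul_one a, ← smul_eq_mul, ← smul_monomial, monomial_one_right_eq_X_pow, map_smul,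
      map_smul, smul_apply, key, smul_zero]

theorem IsInvLaplacian.unique {ζ η η' : L2S} (h : IsInvLaplacian ζ η) (h' : IsInvLaplacian ζ η') :
    η = η' := by
  rw [← sub_eq_zero]
  refine eq_zero_of_hasLaplacian_zero (sub_mem h.1 h'.1) ?_
  rw [hasLaplacian_iff]
  intro φ hφ
  rw [map_sub, hasLaplacian_iff.1 h.2, hasLaplacian_iff.1 h'.2, sub_self, map_zero]

theorem mem_V_iff {k : ℤ} {f : L2S} : f ∈ V k ↔ pairing 1 f = 0 ∧
    ∀ φ (hφ : ContDiff ℝ ∞ φ),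
      pairing ⟨X3 φ, continuous_X3 hφ⟩ f = -(Complex.I * k) * pairing (restr φ hφ) f := by
  rw [← mem_L2b_iff]
  refine and_congr_right fun _ => forall₂_congr fun φ hφ => ?_
  have := integral_smul_mul (Complex.I * k) f (fun x : S2 => φ x)
  rw [this, pairing_apply, pairing_apply, neg_mul]
  rfl

theorem isClosed_V (k : ℤ) : IsClosed (V k : Set L2S) := by
  have : (V k : Set L2S) = {f | pairing 1 f = 0} ∩ ⋂ φ, ⋂ hφ : ContDiff ℝ ∞ φ,
      {f | pairing ⟨X3 φ, continuous_X3 hφ⟩ f = -(Complex.I * k) * pairing (restr φ hφ) f} := by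
    ext f
    simp only [SetLike.mem_coe, mem_V_iff, Set.mem_inter_iff, Set.mem_iInter, Set.mem_ofPred_eq]
  rw [this]
  refine (isClosed_eq (by fun_prop) continuous_const).inter ?_
  exact isClosed_iInter fun φ => isClosed_iInter fun hφ => isClosed_eq (by fun_prop) (by fun_prop)

instance (k : ℤ) : CompleteSpace (V k) := (isClosed_V k).completeSpace_coe

theorem X3_weightFun (k : ℤ) (p : ℂ[X]) (x : S2) :
    X3 (weightFun k p) x = Complex.I * k * weightFun k p x := by
  rw [X3_eq_lieDeriv, lieDeriv_two_weightFun]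

/-- Testing the equation X₃ f = ikf against a function of weight j gives (j + k) times the pairing
equal to zero. The pairing is bilinear, so the surviving weight is -k. -/
theorem pairing_weightMap_of_mem_V {k : ℤ} {f : L2S} (hf : f ∈ V k) {j : ℤ} (hj : j ≠ -k)
    (p : ℂ[X]) : pairing (weightMap j p) f = 0 := by
  have h := (mem_V_iff.1 hf).2 _ (contDiff_weightFun j p)
  have e : (⟨X3 (weightFun j p), continuous_X3 (contDiff_weightFun j p)⟩ : C(S2, ℂ)) =
      (Complex.I * j) • weightMap j p := by
    ext x
    simp [X3_weightFun, weightMap_apply]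
  have e' : restr (weightFun j p) (contDiff_weightFun j p) = weightMap j p := rfl
  rw [e, e', map_smul, smul_apply, smul_eq_mul] at h
  have h2 : (Complex.I * ((j + k : ℤ) : ℂ)) * pairing (weightMap j p) f = 0 := by
    push_cast
    linear_combination h
  have h3 : ((j + k : ℤ) : ℂ) ≠ 0 := by
    rw [Int.cast_ne_zero]
    omega
  exact (mul_eq_zero.1 h2).resolve_left (mul_ne_zero Complex.I_ne_zero h3)

/-- For k ≠ 0 a weight function is, up to the factor ik, its own X₃-derivative, hence has mean zero.
-/
theorem toL2_weightMap_mem_V {k : ℤ} (hk : k ≠ 0) (p : ℂ[X]) : toL2 (weightMap k p) ∈ V k := by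
  have hk' : (k : ℂ) ≠ 0 := by exact_mod_cast hk
  refine ⟨?_, fun φ hφ => ?_⟩
  · rw [mem_L2b_iff, pairing_apply, integral_toL2_mul]
    have h := integral_lieDeriv 2 (contDiff_weightFun k p)
    simp only [lieDeriv_two_weightFun] at h
    rw [integral_const_mul] at h
    simpa [Complex.I_ne_zero, hk', weightMap_apply] using h
  · rw [integral_smul_mul, integral_toL2_mul, integral_toL2_mul]
    simp only [X3_eq_lieDeriv, weightMap_apply]
    rw [integral_mul_lieDeriv 2 (contDiff_weightFun k p) hφ, ← integral_const_mul]
    simp only [lieDeriv_two_weightFun, mul_assoc]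

theorem pairing_weightMap_neg (k : ℤ) (p : ℂ[X]) (f : L2S) : pairing (weightMap (-k) p) f =
    inner ℂ (toL2 (weightMap k (p.map (starRingEnd ℂ)))) f := by
  rw [inner_toL2, star_weightMap, Polynomial.map_map]
  congr 3
  have : (starRingEnd ℂ).comp (starRingEnd ℂ) = RingHom.id ℂ := by ext; simp
  rw [this, Polynomial.map_id]

theorem eq_zero_of_inner_weightMap {k : ℤ} {f : L2S}
    (hf : ∀ j ≠ -k, ∀ p, pairing (weightMap j p) f = 0)
    (h : ∀ p, inner ℂ (toL2 (weightMap k p)) f = 0) : f = 0 := by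
  refine eq_zero_of_pairing_weightMap fun j p => ?_
  by_cases hj : j = -k
  · rw [hj, pairing_weightMap_neg, h]
  · exact hf j hj p

/-- The part of `f` orthogonal to `V k` pairs to zero with every weight function, so it vanishes by
density. Membership in `V k` can thus be tested without derivatives. -/
theorem mem_V_of_pairing {k : ℤ} (hk : k ≠ 0) {f : L2S}
    (hf : ∀ j ≠ -k, ∀ p, pairing (weightMap j p) f = 0) : f ∈ V k := by
  have hP := (V k).starProjection_apply_mem f
  have h0 : f - (V k).starProjection f = 0 := by
    refine eq_zero_of_inner_weightMap (k := k) (fun j hj p => ?_) fun p => ?_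
    · rw [map_sub, hf j hj, pairing_weightMap_of_mem_V hP hj, sub_zero]
    · exact (V k).sub_starProjection_mem_orthogonal f _ (toL2_weightMap_mem_V hk p)
  rw [sub_eq_zero] at h0
  rwa [h0]

theorem legendreOp_map (a : ℕ) (p : ℂ[X]) :
    legendreOp a (p.map (starRingEnd ℂ)) = (legendreOp a p).map (starRingEnd ℂ) := by
  have h2 : starRingEnd ℂ 2 = 2 := map_ofNat _ 2
  simp [legendreOp_apply, derivative_map, smul_eq_C_mul, h2]

/-- The inverse of the Laplace operator on `V k`. -/
theorem exists_inverse_laplacian {k : ℤ} (hk : k ≠ 0) : ∃ K : V k →L[ℂ] V k,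
    (∀ ζ : V k, IsInvLaplacian (ζ : L2S) (K ζ : L2S)) ∧
    (∀ x y, inner ℂ (K x) y = inner ℂ x (K y)) ∧
    ∀ x, lam k.natAbs * ‖K x‖ ^ 2 ≤ -(inner ℂ (K x) x).re := by
  obtain ⟨S, hS⟩ := exists_eigenpolynomials k.natAbs
  have hlam : ∀ n, 0 < lam (k.natAbs + n) := fun n => lam_pos (by omega)
  set E : ℕ → V k := fun n => ⟨toL2 (weightMap k (S n)), toL2_weightMap_mem_V hk _⟩
  have hELap : ∀ n φ (hφ : ContDiff ℝ ∞ φ), pairing (lapMap φ hφ) (E n : L2S) =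
      -(lam (k.natAbs + n) : ℂ) * pairing (restr φ hφ) (E n : L2S) := by
    intro n φ hφ
    have h := hasLaplacian_iff.1 (hasLaplacian_toL2_weightMap k (S n)) φ hφ
    rw [hS, map_smul, map_smul, map_smul] at h
    exact h
  -- Eigenfunctions for distinct eigenvalues: the distributional equation for `E n` is tested
  -- against the conjugate of `E m`, of weight -k and with the real eigenvalue of `E m`.
  have horth : ∀ m n, m ≠ n → inner ℂ (E m) (E n) = 0 := by
    intro m n hmn
    have h1 : inner ℂ (E m) (E n) =
        pairing (weightMap (-k) ((S m).map (starRingEnd ℂ))) (E n : L2S) := by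
      rw [Submodule.coe_inner, inner_toL2, star_weightMap]
    have h2 := hELap n _ (contDiff_weightFun (-k) ((S m).map (starRingEnd ℂ)))
    rw [lapMap_weightFun, Int.natAbs_neg, legendreOp_map, hS, smul_eq_C_mul, Polynomial.map_mul,
      map_C, ← smul_eq_C_mul, map_smul, map_smul, smul_apply] at h2
    change _ = _ * pairing (weightMap (-k) ((S m).map (starRingEnd ℂ))) (E n : L2S) at h2
    rw [← h1, map_neg, Complex.conj_ofReal, smul_eq_mul] at h2
    have h3 : ((lam (k.natAbs + m) : ℂ) - lam (k.natAbs + n)) * inner ℂ (E m) (E n) = 0 := by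
      linear_combination -h2
    refine (mul_eq_zero.1 h3).resolve_left (sub_ne_zero.2 fun h => hmn ?_)
    have := lam_strictMono.injective (Complex.ofReal_injective h)
    omega
  -- Restricting to nonzero vectors permits normalisation without deciding which `E n` vanish; the
  -- span is unaffected.
  let ι := {n : ℕ // E n ≠ 0}
  let e : ι → V k := fun i => ((‖E i‖⁻¹ : ℝ) : ℂ) • E i
  have hsl : ∀ (c : ℂ) (x y : V k), inner ℂ (c • x) y = starRingEnd ℂ c * inner ℂ x y :=
    fun c x y => inner_smul_left x y c
  have hsr : ∀ (c : ℂ) (x y : V k), inner ℂ x (c • y) = c * inner ℂ x y :=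
    fun c x y => inner_smul_right x y c
  have he : Orthonormal ℂ e := by
    constructor
    · intro i
      have : ‖E i‖ ≠ 0 := norm_ne_zero_iff.2 i.2
      rw [norm_smul, Complex.norm_real, norm_inv, norm_norm, inv_mul_cancel₀ this]
    · intro i j hij
      rw [hsl, hsr, horth _ _ (fun h => hij (Subtype.ext h)), mul_zero,
        mul_zero]
  have hspan : (Submodule.span ℂ (Set.range e))ᗮ = ⊥ := by
    rw [Submodule.eq_bot_iff]
    intro f hf
    have h1 : ∀ n, inner ℂ (E n) f = 0 := by
      intro n
      by_cases hn : E n = 0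
      · rw [hn, inner_zero_left]
      · have h2 := hf (e ⟨n, hn⟩) (Submodule.subset_span ⟨_, rfl⟩)
        rw [hsl, mul_eq_zero] at h2
        refine h2.resolve_left ?_
        simpa using hn
    have h3 : ∀ p, inner ℂ (toL2 (weightMap k p)) (f : L2S) = 0 := by
      intro p
      have hp : p ∈ Submodule.span ℂ (Set.range S) := by
        rw [S.span fun i => (leadingCoeff_ne_zero.2 (S.ne_zero i)).isUnit]
        trivial
      induction hp using Submodule.span_induction with
      | mem x h =>
        obtain ⟨n, rfl⟩ := h
        exact h1 n
      | zero => simp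
      | add x y _ _ hx hy => rw [map_add, map_add, inner_add_left, hx, hy, add_zero]
      | smul a x _ hx => rw [map_smul, map_smul, inner_smul_left, hx, mul_zero]
    exact Subtype.ext (eq_zero_of_inner_weightMap
      (fun j hj p => pairing_weightMap_of_mem_V f.2 hj p) h3)
  let b : HilbertBasis ι ℂ (V k) := HilbertBasis.mkOfOrthogonalEqBot he hspan
  have hb : ∀ i, b i = e i := fun i => by simp [b]
  -- The bound κd² ≤ -d with d = -1/λ_{|k|+i} and κ = λ_|k| says λ_|k| ≤ λ_{|k|+i}.
  obtain ⟨K, hK, hKs, hKb⟩ := exists_diagonal b (fun i => -(lam (k.natAbs + i))⁻¹)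
    (lam_pos (Int.natAbs_pos.2 hk)) (by
      intro i
      have h1 := hlam i
      have h2 : lam k.natAbs ≤ lam (k.natAbs + i) := lam_strictMono.monotone (by omega)
      rw [neg_sq, neg_neg, inv_pow, ← div_eq_mul_inv, div_le_iff₀ (by positivity), sq,
        inv_mul_cancel_left₀ h1.ne']
      exact h2)
  refine ⟨K, fun ζ => ⟨(K ζ).2.1, ?_⟩, hKs, hKb⟩
  rw [hasLaplacian_iff]
  intro φ hφ
  -- Both sides are continuous in ζ, so the equation need only be checked on the eigenbasis.
  have h : ((pairing (lapMap φ hφ)).comp (V k).subtypeL).comp K =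
      (pairing (restr φ hφ)).comp (V k).subtypeL := by
    refine ContinuousLinearMap.ext_on (s := Set.range b) ?_ ?_
    · rw [dense_iff_closure_eq, ← Submodule.topologicalClosure_coe, b.dense_span]
      rfl
    · rintro _ ⟨i, rfl⟩
      rw [ContinuousLinearMap.comp_apply, hK, hb]
      simp only [ContinuousLinearMap.comp_apply, e, map_smul, Submodule.subtypeL_apply, hELap]
      have h1 : (lam (k.natAbs + i) : ℂ) ≠ 0 := by exact_mod_cast (hlam i).ne'
      simp only [smul_eq_mul]
      push_cast
      field_simp
  exact congrArg (fun T => T ζ) h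

/-! ### Multiplication by zonal functions on V k -/

/-- The height function `x ↦ x₃` on the sphere. -/
noncomputable def heightMap : C(S2, Set.Icc (-1 : ℝ) 1) where
  toFun x := ⟨(x : E3) 2, abs_le.1 (by
    have h : ‖(x : E3) 2‖ ≤ ‖(x : E3)‖ := PiLp.norm_apply_le _ _
    simpa using h)⟩
  continuous_toFun := by fun_prop

/-- The zonal function with profile `a`. -/
noncomputable def zonal (a : C(Set.Icc (-1 : ℝ) 1, ℝ)) : C(S2, ℂ) :=
  (ContinuousMap.comp ⟨Complex.ofReal, Complex.continuous_ofReal⟩ a).comp heightMap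

theorem zonal_apply (a : C(Set.Icc (-1 : ℝ) 1, ℝ)) (x : S2) : zonal a x = a (heightMap x) := rfl

theorem continuous_zonal : Continuous zonal :=
  (ContinuousMap.continuous_precomp heightMap).comp (ContinuousMap.continuous_postcomp _)

theorem zonal_mul_weightMap (q : ℝ[X]) (k : ℤ) (p : ℂ[X]) :
    zonal (q.toContinuousMapOn _) * weightMap k p =
      weightMap k (q.map (algebraMap ℝ ℂ) * p) := by
  ext x
  simp only [ContinuousMap.mul_apply, weightMap_apply, weightFun, eval_mul, zonal_apply]
  have h : eval (heightForm x) (q.map (algebraMap ℝ ℂ)) =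
      ((eval ((x : E3) 2) q : ℝ) : ℂ) := by
    rw [heightForm_apply, eval_map]
    exact eval₂_at_apply (algebraMap ℝ ℂ) _
  rw [h]
  change ((eval ((x : E3) 2) q : ℝ) : ℂ) * _ = _
  ring

/-- Multiplication by a polynomial in x₂ preserves weights, so the pairing test for `V k` passes;
Weierstrass approximation extends it to continuous profiles. -/
theorem mulL_zonal_mem_V {k : ℤ} (hk : k ≠ 0) (a : C(Set.Icc (-1 : ℝ) 1, ℝ)) {f : L2S}
    (hf : f ∈ V k) : mulL (zonal a) f ∈ V k := by
  refine mem_V_of_pairing hk fun j hj p => ?_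
  rw [pairing_mulL]
  have hcl : IsClosed {a | pairing (zonal a * weightMap j p) f = 0} :=
    isClosed_eq (((pairing.flip f).continuous.comp (continuous_zonal.mul continuous_const)))
      continuous_const
  have hsub : (polynomialFunctions (Set.Icc (-1 : ℝ) 1) : Set C(Set.Icc (-1 : ℝ) 1, ℝ)) ⊆
      {a | pairing (zonal a * weightMap j p) f = 0} := by
    rw [polynomialFunctions_coe]
    rintro _ ⟨q, rfl⟩
    change pairing (zonal (q.toContinuousMapOn _) * weightMap j p) f = 0
    rw [zonal_mul_weightMap, pairing_weightMap_of_mem_V hf hj]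
  exact closure_minimal hsub hcl (continuousMap_mem_polynomialFunctions_closure (-1) 1 a)

/-- Multiplication by a zonal function on `V k`. -/
theorem exists_mul_zonal {k : ℤ} (hk : k ≠ 0) {a : ℝ → ℝ} (ha : ContinuousOn a (Set.Icc (-1) 1)) :
    ∃ T : V k →L[ℂ] V k, ∀ ζ : V k, ∀ᵐ x ∂surf,
      (T ζ : L2S) x = (a ((x : E3) 2) : ℂ) * (ζ : L2S) x := by
  let a' : C(Set.Icc (-1 : ℝ) 1, ℝ) := ⟨_, ha.domRestrict⟩
  refine ⟨((mulL (zonal a')).comp (V k).subtypeL).codRestrict (V k)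
    fun ζ => mulL_zonal_mem_V hk a' ζ.2, fun ζ => ?_⟩
  exact coeFn_mulL (zonal a') ζ

theorem integrable_re_inner (f g : L2S) : Integrable (fun x => (inner ℂ (f x) (g x)).re) surf :=
  (L2.integrable_inner (𝕜 := ℂ) f g).re

theorem re_inner_eq_integral (f g : L2S) :
    (inner ℂ f g).re = ∫ x, (inner ℂ (f x) (g x)).re ∂surf := by
  rw [L2.inner_def]
  exact (integral_re (𝕜 := ℂ) (L2.integrable_inner f g)).symm

section Multiplication

variable {k : ℤ} {a b : ℝ → ℝ} {S T : V k →L[ℂ] V k}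

theorem inner_mul_zonal
    (hT : ∀ ζ : V k, ∀ᵐ x ∂surf, (T ζ : L2S) x = (a ((x : E3) 2) : ℂ) * (ζ : L2S) x) (f g : V k) :
    inner ℂ (T f) g = inner ℂ f (T g) := by
  rw [Submodule.coe_inner, Submodule.coe_inner, L2.inner_def, L2.inner_def]
  refine integral_congr_ae ?_
  filter_upwards [hT f, hT g] with x h1 h2
  rw [h1, h2]
  simp
  ring

theorem mul_zonal_comm
    (hS : ∀ ζ : V k, ∀ᵐ x ∂surf, (S ζ : L2S) x = (a ((x : E3) 2) : ℂ) * (ζ : L2S) x)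
    (hT : ∀ ζ : V k, ∀ᵐ x ∂surf, (T ζ : L2S) x = (b ((x : E3) 2) : ℂ) * (ζ : L2S) x) (f : V k) :
    S (T f) = T (S f) := by
  refine Subtype.ext (Lp.ext ?_)
  filter_upwards [hS (T f), hT f, hT (S f), hS f] with x h1 h2 h3 h4
  rw [h1, h2, h3, h4]
  ring

theorem coord_mem_Icc (x : S2) : (x : E3) 2 ∈ Set.Icc (-1 : ℝ) 1 := (heightMap x).2

/-- Integrate the pointwise bound a² ≤ C|a| against |f|²; with one sign, |a| = σa for a constant σ =
±1, so the right side is controlled by the quadratic form. -/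
theorem norm_mul_zonal_sq_le
    (hT : ∀ ζ : V k, ∀ᵐ x ∂surf, (T ζ : L2S) x = (a ((x : E3) 2) : ℂ) * (ζ : L2S) x)
    {C : ℝ} (hC : 0 ≤ C) (haC : ∀ s ∈ Set.Icc (-1 : ℝ) 1, |a s| ≤ C)
    (hsign : (∀ s ∈ Set.Icc (-1 : ℝ) 1, 0 ≤ a s) ∨ (∀ s ∈ Set.Icc (-1 : ℝ) 1, a s ≤ 0))
    (f : V k) : ‖T f‖ ^ 2 ≤ C * |(inner ℂ f (T f)).re| := by
  have key : ∀ σ : ℝ, |σ| = 1 → (∀ s ∈ Set.Icc (-1 : ℝ) 1, 0 ≤ σ * a s) →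
      ‖T f‖ ^ 2 ≤ C * |(inner ℂ f (T f)).re| := by
    intro σ hσ h0
    have h1 : ‖T f‖ ^ 2 = ∫ x, (inner ℂ ((T f : L2S) x) ((T f : L2S) x)).re ∂surf := by
      rw [← re_inner_self, Submodule.coe_inner, re_inner_eq_integral]
    have h2 : (inner ℂ f (T f)).re = ∫ x, (inner ℂ ((f : L2S) x) ((T f : L2S) x)).re ∂surf := by
      rw [Submodule.coe_inner, re_inner_eq_integral]
    have h3 : ‖T f‖ ^ 2 ≤ C * (σ * (inner ℂ f (T f)).re) := by
      rw [h1, h2, ← mul_assoc, ← integral_const_mul]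
      refine integral_mono_ae (integrable_re_inner _ _) ((integrable_re_inner _ _).const_mul _) ?_
      filter_upwards [hT f] with x hx
      have e1 : (inner ℂ ((f : L2S) x) ((T f : L2S) x)).re =
          a ((x : E3) 2) * ‖(f : L2S) x‖ ^ 2 := by
        rw [hx, ← smul_eq_mul, inner_smul_right, Complex.re_ofReal_mul, re_inner_self]
      rw [re_inner_self, e1, hx, norm_mul, mul_pow, Complex.norm_real, Real.norm_eq_abs]
      have h4 := h0 _ (coord_mem_Icc x)
      have h5 := haC _ (coord_mem_Icc x)
      have h6 : σ * a ((x : E3) 2) = |a ((x : E3) 2)| := by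
        rw [← abs_of_nonneg h4, abs_mul, hσ, one_mul]
      have h7 : C * σ * (a ((x : E3) 2) * ‖(f : L2S) x‖ ^ 2) =
          C * |a ((x : E3) 2)| * ‖(f : L2S) x‖ ^ 2 := by
        rw [← h6]; ring
      rw [h7, sq |a _|]
      gcongr
    refine h3.trans (mul_le_mul_of_nonneg_left ?_ hC)
    refine (le_abs_self _).trans ?_
    rw [abs_mul, hσ, one_mul]
  rcases hsign with h | h
  · exact key 1 (by simp) (by simpa using h)
  · exact key (-1) (by simp) (by simpa using h)

end Multiplication

/-! ### The operator M_k and its spectrum -/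

theorem IsM.unique {A B : ℝ → ℝ} {k : ℤ} {M M' : V k →L[ℂ] V k} (h : IsM A B k M)
    (h' : IsM A B k M') : M = M' := by
  ext1 ζ
  obtain ⟨η, hη, hM⟩ := h ζ
  obtain ⟨η', hη', hM'⟩ := h' ζ
  obtain rfl := hη.unique hη'
  refine Subtype.ext (Lp.ext ?_)
  filter_upwards [hM, hM'] with x h1 h2
  rw [h1, h2]

theorem exists_isM_spectrum_real {A B : ℝ → ℝ} (hA : ContinuousOn A (Set.Icc (-1) 1))
    (hB : ContinuousOn B (Set.Icc (-1) 1)) {Ω μ : ℝ} (hμ : 0 ≤ μ)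
    (hBA : ∀ s ∈ Set.Icc (-1 : ℝ) 1, B s = Ω + μ * A s) {k : ℤ} (hk : k ≠ 0)
    (h : ((∀ s ∈ Set.Icc (-1 : ℝ) 1, 0 ≤ B s) ∨ (∀ s ∈ Set.Icc (-1 : ℝ) 1, B s ≤ 0)) ∨
      μ ≤ lam k.natAbs) :
    ∃ M : V k →L[ℂ] V k, IsM A B k M ∧ spectrum ℂ M ⊆ Set.range (fun r : ℝ => (r : ℂ)) := by
  obtain ⟨K, hK, hKs, hKb⟩ := exists_inverse_laplacian hk
  obtain ⟨TA, hTA⟩ := exists_mul_zonal hk hA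
  obtain ⟨TB, hTB⟩ := exists_mul_zonal hk hB
  refine ⟨TA + TB ∘L K, fun ζ => ⟨K ζ, hK ζ, ?_⟩, ?_⟩
  · filter_upwards [hTA ζ, hTB (K ζ), Lp.coeFn_add (TA ζ : L2S) (TB (K ζ) : L2S)] with x h1 h2 h3
    rw [← h1, ← h2]
    exact h3
  have hdef : ((∀ s ∈ Set.Icc (-1 : ℝ) 1, 0 ≤ B s) ∨ (∀ s ∈ Set.Icc (-1 : ℝ) 1, B s ≤ 0)) →
      spectrum ℂ (TA + TB ∘L K) ⊆ Set.range (fun r : ℝ => (r : ℂ)) := by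
    intro hsign
    obtain ⟨C, hC⟩ := isCompact_Icc.exists_bound_of_continuousOn hB
    have hC0 : 0 ≤ C := (norm_nonneg _).trans (hC 0 (by simp))
    exact spectrum_subset_real_of_definite (inner_mul_zonal hTA) (inner_mul_zonal hTB)
      (mul_zonal_comm hTA hTB) hKs (norm_mul_zonal_sq_le hTB hC0 hC hsign)
  rcases h with h | h
  · exact hdef h
  -- For μ = 0 the profile `B` is the constant Ω, which has one sign.
  rcases hμ.eq_or_lt with h0 | h0
  · refine hdef ((le_total 0 Ω).imp (fun hΩ s hs => ?_) fun hΩ s hs => ?_) <;>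
      simpa [hBA s hs, ← h0] using hΩ
  · have hTBA : TB = (Ω : ℂ) • ContinuousLinearMap.id ℂ (V k) + (μ : ℂ) • TA := by
      ext1 ζ
      refine Subtype.ext (Lp.ext ?_)
      have e : (((Ω : ℂ) • ContinuousLinearMap.id ℂ (V k) + (μ : ℂ) • TA) ζ : L2S) =
          (Ω : ℂ) • (ζ : L2S) + (μ : ℂ) • (TA ζ : L2S) := rfl
      rw [e]
      filter_upwards [hTA ζ, hTB ζ, Lp.coeFn_add ((Ω : ℂ) • (ζ : L2S)) ((μ : ℂ) • (TA ζ : L2S)),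
        Lp.coeFn_smul (Ω : ℂ) (ζ : L2S), Lp.coeFn_smul (μ : ℂ) (TA ζ : L2S)] with x h1 h2 h3 h4 h5
      rw [h2, h3, Pi.add_apply, h4, h5, Pi.smul_apply, Pi.smul_apply, h1, hBA _ (coord_mem_Icc x)]
      simp only [smul_eq_mul]
      push_cast
      ring
    rw [hTBA]
    exact spectrum_subset_real_of_affine h0 h (inner_mul_zonal hTA) hKs hKb

end ZonalSphere

theorem proposition4p3p7 (ν : ℕ) (f : ℝ → ℝ) (hf : ZonalSphere.IsZonalEigenfunction f ν)
    (α Ω : ℝ) (A B : ℝ → ℝ)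
    (hA : ∀ s ∈ Set.Icc (-1 : ℝ) 1, A s = α * ZonalSphere.D f s)
    (hB : ∀ s ∈ Set.Icc (-1 : ℝ) 1, B s = Ω + ZonalSphere.lam ν * α * ZonalSphere.D f s)
    (k : ℤ) (hk : k ≠ 0)
    (h : ((∀ s ∈ Set.Icc (-1 : ℝ) 1, 0 ≤ B s) ∨ (∀ s ∈ Set.Icc (-1 : ℝ) 1, B s ≤ 0)) ∨
      ZonalSphere.lam ν ≤ ZonalSphere.lam k.natAbs) :
    (∃! M : ZonalSphere.V k →L[ℂ] ZonalSphere.V k, ZonalSphere.IsM A B k M) ∧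
      ∀ M : ZonalSphere.V k →L[ℂ] ZonalSphere.V k, ZonalSphere.IsM A B k M →
        spectrum ℂ M ⊆ Set.range (fun r : ℝ => (r : ℂ)) := by
  have hD : ContinuousOn (ZonalSphere.D f) (Set.Icc (-1) 1) :=
    hf.1.continuousOn_derivWithin (uniqueDiffOn_Icc (by norm_num)) (by simp)
  have hlam : 0 ≤ ZonalSphere.lam ν := by unfold ZonalSphere.lam; positivity
  obtain ⟨M, hM, hspec⟩ := ZonalSphere.exists_isM_spectrum_real (A := A) (B := B) (Ω := Ω)
    ((continuousOn_const.mul hD).congr hA)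
    ((continuousOn_const.add (continuousOn_const.mul hD)).congr hB) hlam
    (fun s hs => by rw [hB s hs, hA s hs]; ring) hk h
  refine ⟨⟨M, hM, fun M' hM' => hM'.unique hM⟩, fun M' hM' => ?_⟩
  rw [hM'.unique hM]
  exact hspec
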